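/- **Setting.** Let $\Sigma=\Sigma_C\uplus\Sigma_D$ be a signature whose symbols in $\Sigma_D$ are the *defined symbols*, and let $\mathcal V$ be a set of variables. For every $f\in\Sigma_D$ there is a fresh *tuple symbol* $f^\#$ of the same arity; $\Sigma^\#$ is the set of tuple symbols. For $t=f(t_1,\dots,t_n)\in\mathcal T(\Sigma,\mathcal V)$ with $f\in\Sigma_D$ let $t^\#=f^\#(t_1,\dots,t_n)$. For $r\in\mathcal T(\Sigma,\mathcal V)$, $dp(r)$ is the multiset of all $t^\#$ where $t$ ranges over the occurrences of subterms of $r$ with defined root. A *compound term* is a finite multiset $\{s_1,\dots,s_n\}$ of terms from $\mathcal T(\Sigma\uplus\Sigma^\#,\mathcal V)$ (also written $\mathrm{Com}_n(s_1,\dots,s_n)$; nesting and order of compound symbols are disregarded). A *finite multi-distribution* is a finite multiset of pairs $(p:a)$ with $0<p\le 1$ whose probabilities sum to $1$. Substitutions map variables to $\mathcal T(\Sigma\uplus\Sigma^\#,\mathcal V)$; $s|_\pi$ is the subterm of $s$ at position $\pi$, and $s[u]_\pi$ is $s$ with this subterm replaced by $u$. A *PTRS* is a finite set $\mathcal S$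 of rules $\ell\to\{p_1:r_1,\dots,p_k:r_k\}$, where $\ell,r_j\in\mathcal T(\Sigma,\mathcal V)$, $\ell\notin\mathcal V$, $\mathcal V(r_j)\subseteq\mathcal V(\ell)$, and the right-hand side is a finite multi-distribution. $\mathtt{NF}_{\mathcal S}$ is the set of terms over $\Sigma\uplus\Sigma^\#$ that have no subterm $\ell\sigma$ with $\ell$ a left-hand side of $\mathcal S$. A *PPTRS* is a finite set $\mathcal P$ of rules (dependency tuples) $\langle\ell^\#,\ell\rangle\to\{p_1:\langle d_1,r_1\rangle,\dots,p_k:\langle d_k,r_k\rangle\}$ such that the rules $\ell\to\{p_1:r_1,\dots,p_k:r_k\}$ form a PTRS, the root of $\ell$ is defined, and each $d_j$ is a sub-multiset of $dp(r_j)$. A *DP problem* is a pair $(\mathcal P,\mathcal S)$ of a PPTRS and a PTRS (with the same $\Sigma,\Sigma_D,\mathcal V$). *Steps.* A $(\mathcal P,\mathcal S)$-step takes $\mathrm{Com}_n(s_1,\dots,s_n)$ to $\{p_1:b_1,\dots,p_k:b_k\}$ if there are a rule $\langle\ell^\#,\ell\rangle\to\{p_1:\langle d_1,r_1\rangle,\dots,p_k:\langle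 d_k,r_k\rangle\}$ of $\mathcal P$, a substitution $\sigma$ and an index $i$ with $s_i=\ell^\#\sigma\in\mathtt{NF}_{\mathcal S}$, such that $b_j$ arises from $\mathrm{Com}_n(s_1,\dots,s_n)$ by replacing $s_i$ by the elements of $d_j\sigma$, and every other $s_{i'}$ either stays the same in all $b_j$, or, provided that $\ell\to\{p_1:r_1,\dots,p_k:r_k\}\in\mathcal S$ and $s_{i'}|_\tau=\ell\sigma$ for some position $\tau$, is replaced by $s_{i'}[r_j\sigma]_\tau$ in each $b_j$. An $\mathcal S$-step takes $\mathrm{Com}_n(s_1,\dots,s_n)$ to $\{p_1:b_1,\dots,p_k:b_k\}$ if there are a rule $\ell\to\{p_1:r_1,\dots,p_k:r_k\}$ of $\mathcal S$, a substitution $\sigma$, an index $i$ and a position $\pi$ with $s_i|_\pi=\ell\sigma$ and all proper subterms of $\ell\sigma$ in $\mathtt{NF}_{\mathcal S}$, such that in $b_j$ the term $s_i$ is replaced by $s_i[r_j\sigma]_\pi$, and every other $s_{i'}$ either stays the same in all $b_j$, or, provided that $s_{i'}|_\tau=\ell\sigma$ for some position $\tau$, is replaced by $s_{i'}[r_j\sigma]_\tau$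 in each $b_j$. *iAST.* An innermost $(\mathcal P,\mathcal S)$-*chain tree* is a non-empty, finitely branching, possibly infinite rooted directed tree in which every node $v$ is labelled by a probability $p_v\in(0,1]$ and a compound term $t_v$, the root having probability $1$, together with a set $P$ of inner nodes, such that for every node $v$ with set of children $\{w_1,\dots,w_k\}$, $k\ge 1$, there is a step from $t_v$ to $\{\tfrac{p_{w_1}}{p_v}:t_{w_1},\dots,\tfrac{p_{w_k}}{p_v}:t_{w_k}\}$, namely a $(\mathcal P,\mathcal S)$-step if $v\in P$ and an $\mathcal S$-step otherwise, and such that every infinite path contains infinitely many nodes of $P$. The DP problem $(\mathcal P,\mathcal S)$ is *iAST* if for every such tree the probabilities of all its leaves sum to $1$. *Dependency graph.* Let $\mathrm{np}(\mathcal S)$ be the TRS of all rules $\ell\to r_j$ obtained from rules $\ell\to\{p_1:r_1,\dots,p_k:r_k\}$ of $\mathcal S$. The (innermost) $(\mathcal P,\mathcal S)$-dependency graph has node set $\mathcal P$ and an edge from $\langle\ell_1^\#,\ell_1\rangle\to\{p_1:\langle d_1,r_1\rangle,\dots,p_k:\langle d_k,r_k\rangle\}$ to $\langle\ell_2^\#,\ell_2\rangle\to\dots$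 if there are substitutions $\sigma_1,\sigma_2$ and a term $t^\#\in d_j$ for some $j$ such that $t^\#\sigma_1$ rewrites innermost in zero or more steps of $\mathrm{np}(\mathcal S)$ to $\ell_2^\#\sigma_2$, and $\ell_1^\#\sigma_1,\ell_2^\#\sigma_2\in\mathtt{NF}_{\mathcal S}$. An *SCC* is a maximal non-empty set of nodes such that between any two (possibly equal) of its nodes there is a non-empty path that traverses only nodes of the set. **Theorem.** Consider the processor that maps every DP problem $(\mathcal P,\mathcal S)$ to $\{(\mathcal P_1,\mathcal S),\dots,(\mathcal P_n,\mathcal S)\}$, where $\mathcal P_1,\dots,\mathcal P_n$ are the SCCs of the $(\mathcal P,\mathcal S)$-dependency graph. This processor is sound and complete: for every DP problem $(\mathcal P,\mathcal S)$, - (soundness) if $(\mathcal P_i,\mathcal S)$ is iAST for all $1\le i\le n$, then $(\mathcal P,\mathcal S)$ is iAST; - (completeness) if $(\mathcal P,\mathcal S)$ is iAST, then $(\mathcal P_i,\mathcal S)$ is iAST for all $1\le i\le n$. -/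

import Mathlib

universe u v w

namespace ProbDP

/-! ### Terms, positions, substitutions

Terms are Mathlib's first-order terms (the relation symbols of a language play no role).
The signature is `Σ = C ⊎ D`, where the symbols of `D` are the defined symbols; for each of
them there is a fresh tuple symbol of the same arity, so that `Σ ⊎ Σ#` is `(C ⊎ D) ⊎ D`. -/

section Terms

variable {L : FirstOrder.Language.{u, v}} {X : Type w}

/-- A position: a list of argument indices (counted from `0`). -/
abbrev Pos : Type := List ℕ

/-- The subterm `t|_π`, if `π` is a position of `t`. -/
def subtermAt : L.Term X → Pos → Option (L.Term X)
  | t, [] => some t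
  | .var _, _ :: _ => none
  | .func (l := n) _ ts, i :: π => if h : i < n then subtermAt (ts ⟨i, h⟩) π else none

/-- The term `t[u]_π` (only used when `π` is a position of `t`). -/
def replaceAt : L.Term X → Pos → L.Term X → L.Term X
  | _, [], u => u
  | .var x, _ :: _, _ => .var x
  | .func (l := n) f ts, i :: π, u =>
      if h : i < n then
        .func f (Function.update ts ⟨i, h⟩ (replaceAt (ts ⟨i, h⟩) π u))
      else .func f ts

/-- `u` is a proper subterm of `t`. -/
def IsProperSubterm (u t : L.Term X) : Prop :=
  ∃ π : Pos, π ≠ [] ∧ subtermAt t π = some u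

open Classical in
/-- The set `𝒱(t)` of variables of a term. -/
noncomputable def vars (t : L.Term X) : Finset X := t.varFinset

end Terms

variable {C D : FirstOrder.Language.{u, v}} {X : Type w}

/-- `T(Σ, 𝒱)`, where `Σ = C ⊎ D`. -/
abbrev BTerm (C D : FirstOrder.Language.{u, v}) (X : Type w) := (C.sum D).Term X

/-- `T(Σ ⊎ Σ#, 𝒱)`. -/
abbrev ETerm (C D : FirstOrder.Language.{u, v}) (X : Type w) := ((C.sum D).sum D).Term X

/-- The inclusion `T(Σ, 𝒱) ⊆ T(Σ ⊎ Σ#, 𝒱)`. -/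
def emb (t : BTerm C D X) : ETerm C D X := FirstOrder.Language.LHom.sumInl.onTerm t

/-- The defined symbol `f` as an element of `Σ`. -/
def defSym {n : ℕ} (f : D.Functions n) : (C.sum D).Functions n := Sum.inr f

/-- The tuple symbol `f#` as an element of `Σ ⊎ Σ#`. -/
def tupSym {n : ℕ} (f : D.Functions n) : ((C.sum D).sum D).Functions n := Sum.inr f

/-- The root of `t` is a defined symbol. -/
def HasDefinedRoot (t : BTerm C D X) : Prop :=
  ∃ (n : ℕ) (f : D.Functions n) (ts : Fin n → BTerm C D X), t = .func (defSym f) ts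

/-- `t# = f#(t₁, …, tₙ)` for `t = f(t₁, …, tₙ)` with a defined symbol `f`
(it is only used for such terms). -/
def sharp : BTerm C D X → ETerm C D X
  | .var x => .var x
  | .func (Sum.inl c) ts => emb (.func (Sum.inl c) ts)
  | .func (Sum.inr f) ts => .func (tupSym f) fun i => emb (ts i)

/-- The multiset `MSub_D(t)` of all (occurrences of) subterms of `t` with defined root. -/
def msubD : BTerm C D X → Multiset (BTerm C D X)
  | .var _ => 0
  | .func (Sum.inl _) ts => ∑ i, msubD (ts i)
  | .func (Sum.inr f) ts => .func (defSym f) ts ::ₘ ∑ i, msubD (ts i)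

/-- A (normalized) compound term `Com_n(s₁, …, sₙ)` up to `≈`, i.e. its content: the multiset
`{s₁, …, sₙ}`. -/
abbrev Compound (C D : FirstOrder.Language.{u, v}) (X : Type w) := Multiset (ETerm C D X)

/-- The content of `dp(r)`. -/
def dp (r : BTerm C D X) : Compound C D X := (msubD r).map sharp

/-! ### Probabilistic and non-probabilistic rewriting -/

/-- The finite multiset `μ` of pairs `(p : a)` is a finite multi-distribution. -/
def IsMultiDist {A : Type*} (μ : Multiset (ℝ × A)) : Prop :=
  (∀ q ∈ μ, 0 < q.1 ∧ q.1 ≤ 1) ∧ (μ.map Prod.fst).sum = 1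

/-- A rule `ℓ → {p₁ : r₁, …, p_k : r_k}` over `Σ`. -/
@[ext]
structure PRule (C D : FirstOrder.Language.{u, v}) (X : Type w) where
  lhs : BTerm C D X
  rhs : Multiset (ℝ × BTerm C D X)

/-- `R` is a probabilistic term rewrite system over `Σ`. -/
def IsPTRS (R : Set (PRule C D X)) : Prop :=
  R.Finite ∧ ∀ ρ ∈ R, IsMultiDist ρ.rhs ∧ (∀ x, ρ.lhs ≠ .var x) ∧
    ∀ q ∈ ρ.rhs, vars q.2 ⊆ vars ρ.lhs

/-- The rewrite relation `→_R` of a PTRS on `T(Σ ⊎ Σ#, 𝒱)`. -/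
def PRewrites (R : Set (PRule C D X)) (s : ETerm C D X) (μ : Multiset (ℝ × ETerm C D X)) :
    Prop :=
  ∃ ρ ∈ R, ∃ (π : Pos) (σ : X → ETerm C D X),
    subtermAt s π = some ((emb ρ.lhs).subst σ) ∧
    μ = ρ.rhs.map fun q => (q.1, replaceAt s π ((emb q.2).subst σ))

/-- `NF_R`, the set of normal forms w.r.t. the PTRS `R`. -/
def NF (R : Set (PRule C D X)) : Set (ETerm C D X) :=
  {s | ∀ μ, ¬ PRewrites R s μ}

/-- The rewrite relation of a non-probabilistic TRS (a set of pairs `(ℓ, r)`). -/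
def Rewrites (R : Set (BTerm C D X × BTerm C D X)) (s t : ETerm C D X) : Prop :=
  ∃ ρ ∈ R, ∃ (π : Pos) (σ : X → ETerm C D X),
    subtermAt s π = some ((emb ρ.1).subst σ) ∧ t = replaceAt s π ((emb ρ.2).subst σ)

/-- The innermost rewrite relation of a non-probabilistic TRS: all proper subterms of the redex
are in normal form. -/
def InnermostRewrites (R : Set (BTerm C D X × BTerm C D X)) (s t : ETerm C D X) : Prop :=
  ∃ ρ ∈ R, ∃ (π : Pos) (σ : X → ETerm C D X),
    subtermAt s π = some ((emb ρ.1).subst σ) ∧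
    (∀ u, IsProperSubterm u ((emb ρ.1).subst σ) → ∀ u', ¬ Rewrites R u u') ∧
    t = replaceAt s π ((emb ρ.2).subst σ)

/-- The non-probabilistic variant `np(S)` of a PTRS. -/
def np (S : Set (PRule C D X)) : Set (BTerm C D X × BTerm C D X) :=
  {ρ | ∃ ρ' ∈ S, ρ.1 = ρ'.lhs ∧ ∃ q ∈ ρ'.rhs, ρ.2 = q.2}

/-! ### Coupled dependency tuples and DP problems -/

/-- A rule `⟨ℓ#, ℓ⟩ → {p₁ : ⟨d₁, r₁⟩, …, p_k : ⟨d_k, r_k⟩}`.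
The first component `ℓ#` of the left-hand side is determined by `ℓ`, and each `d_j` is given by
its content. -/
@[ext]
structure CoupledDT (C D : FirstOrder.Language.{u, v}) (X : Type w) where
  lhs : BTerm C D X
  rhs : Multiset (ℝ × Compound C D X × BTerm C D X)

/-- The first component `ℓ#` of the left-hand side. -/
def CoupledDT.lhsSharp (ρ : CoupledDT C D X) : ETerm C D X := sharp ρ.lhs

/-- The rule `ℓ → {p₁ : r₁, …, p_k : r_k}` of `proj₂`. -/
def CoupledDT.proj₂ (ρ : CoupledDT C D X) : PRule C D X where
  lhs := ρ.lhs
  rhs := ρ.rhs.map fun q => (q.1, q.2.2)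

/-- `P` is a probabilistic pair term rewrite system. The relation `≤` on multisets is inclusion
with multiplicities. -/
def IsPPTRS (P : Set (CoupledDT C D X)) : Prop :=
  P.Finite ∧ IsPTRS (CoupledDT.proj₂ '' P) ∧
    ∀ ρ ∈ P, HasDefinedRoot ρ.lhs ∧ ∀ q ∈ ρ.rhs, q.2.1 ≤ dp q.2.2

lemma IsPPTRS.mono {P P' : Set (CoupledDT C D X)} (h : IsPPTRS P) (hP : P' ⊆ P) :
    IsPPTRS P' :=
  ⟨h.1.subset hP,
    ⟨h.2.1.1.subset (Set.image_mono hP), fun ρ hρ => h.2.1.2 ρ (Set.image_mono hP hρ)⟩,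
    fun ρ hρ => h.2.2 ρ (hP hρ)⟩

/-- What happens in a step with an argument `s` of the compound symbol that is not the main
argument: it stays the same, or the redex at position `τ` is replaced by `u`. -/
def stepSide (x : ETerm C D X × Option Pos) (u : ETerm C D X) : ETerm C D X :=
  match x.2 with
  | none => x.1
  | some τ => replaceAt x.1 τ u

/-- The step relation of a PPTRS `P` w.r.t. a PTRS `S` on compound terms. The multiset `rest`
lists the arguments other than the main one, each with the position (if any) at which it is
rewritten simultaneously by the rule of `proj₂`; the latter requires that this rule is in `S`. -/
def StepPS (P : Set (CoupledDT C D X)) (S : Set (PRule C D X)) (a : Compound C D X)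
    (ν : Multiset (ℝ × Compound C D X)) : Prop :=
  ∃ ρ ∈ P, ∃ (σ : X → ETerm C D X) (rest : Multiset (ETerm C D X × Option Pos)),
    a = ρ.lhsSharp.subst σ ::ₘ rest.map Prod.fst ∧
    ρ.lhsSharp.subst σ ∈ NF S ∧
    (∀ x ∈ rest, ∀ τ, x.2 = some τ →
      ρ.proj₂ ∈ S ∧ subtermAt x.1 τ = some ((emb ρ.lhs).subst σ)) ∧
    ν = ρ.rhs.map fun q =>
      (q.1, q.2.1.map (fun t => t.subst σ) +
        rest.map fun x => stepSide x ((emb q.2.2).subst σ))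

/-- The step relation of a PTRS `S` on compound terms: an innermost step in the main argument
`s`, together with optional simultaneous steps of the same redex in the other arguments. -/
def StepS (S : Set (PRule C D X)) (a : Compound C D X) (ν : Multiset (ℝ × Compound C D X)) :
    Prop :=
  ∃ ρ ∈ S, ∃ (σ : X → ETerm C D X) (s : ETerm C D X) (π : Pos)
      (rest : Multiset (ETerm C D X × Option Pos)),
    a = s ::ₘ rest.map Prod.fst ∧
    subtermAt s π = some ((emb ρ.lhs).subst σ) ∧
    (∀ u, IsProperSubterm u ((emb ρ.lhs).subst σ) → u ∈ NF S) ∧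
    (∀ x ∈ rest, ∀ τ, x.2 = some τ → subtermAt x.1 τ = some ((emb ρ.lhs).subst σ)) ∧
    ν = ρ.rhs.map fun q =>
      (q.1, replaceAt s π ((emb q.2).subst σ) ::ₘ
        rest.map fun x => stepSide x ((emb q.2).subst σ))

/-- A DP problem `(P, S)`. -/
@[ext]
structure DPProblem (C D : FirstOrder.Language.{u, v}) (X : Type w) where
  P : Set (CoupledDT C D X)
  S : Set (PRule C D X)
  isPPTRS : IsPPTRS P
  isPTRS : IsPTRS S

/-- The DP problem `(P', S)` for a subset `P'` of `P`. -/
def DPProblem.restrict (Q : DPProblem C D X) (P' : Set (CoupledDT C D X)) (h : P' ⊆ Q.P) :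
    DPProblem C D X where
  P := P'
  S := Q.S
  isPPTRS := Q.isPPTRS.mono h
  isPTRS := Q.isPTRS

/-! ### Chain trees -/

/-- An innermost `(P, S)`-chain tree. Since finitely branching trees are countable, it is no
restriction to take the type of nodes in `Type`. -/
structure ChainTree (Q : DPProblem C D X) where
  Node : Type
  Edge : Node → Node → Prop
  /-- The graph is a directed tree with this root. -/
  root : Node
  reachable : ∀ x, Relation.ReflTransGen Edge root x
  root_no_pred : ∀ x, ¬ Edge x root
  pred_unique : ∀ x x' y, Edge x y → Edge x' y → x = x'
  finite_succ : ∀ x, {y | Edge x y}.Finite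
  /-- The labels. -/
  prob : Node → ℝ
  term : Node → Compound C D X
  prob_pos : ∀ x, 0 < prob x
  prob_le_one : ∀ x, prob x ≤ 1
  prob_root : prob root = 1
  /-- The nodes where `P` is used; they are inner nodes. -/
  PNode : Set Node
  inner_of_PNode : ∀ x ∈ PNode, ∃ y, Edge x y
  stepP : ∀ x ∈ PNode, StepPS Q.P Q.S (term x)
    ((finite_succ x).toFinset.val.map fun y => (prob y / prob x, term y))
  /-- All other inner nodes are steps with `S`. -/
  stepS : ∀ x, x ∉ PNode → (∃ y, Edge x y) → StepS Q.S (term x)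
    ((finite_succ x).toFinset.val.map fun y => (prob y / prob x, term y))
  infinite_PNode : ∀ path : ℕ → Node, (∀ n, Edge (path n) (path (n + 1))) →
    {n | path n ∈ PNode}.Infinite

namespace ChainTree

variable {Q : DPProblem C D X}

/-- The set of leaves. -/
def Leaf (T : ChainTree Q) : Set T.Node := {x | ∀ y, ¬ T.Edge x y}

/-- `|T|_Leaf`, the sum of the probabilities of all leaves. -/
noncomputable def leafProb (T : ChainTree Q) : ENNReal :=
  ∑' x : T.Leaf, ENNReal.ofReal (T.prob x)

end ChainTree

/-- The DP problem is innermost almost-surely terminating. -/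
def DPProblem.IsIAST (Q : DPProblem C D X) : Prop :=
  ∀ T : ChainTree Q, T.leafProb = 1

/-! ### DP processors and the dependency graph -/

/-- A DP processor maps each DP problem to a finite set of DP problems. -/
structure Processor (C D : FirstOrder.Language.{u, v}) (X : Type w) where
  proc : DPProblem C D X → Set (DPProblem C D X)
  finite_proc : ∀ Q, (proc Q).Finite

/-- Soundness of a DP processor. -/
def Processor.IsSound (F : Processor C D X) : Prop :=
  ∀ Q, (∀ Q' ∈ F.proc Q, Q'.IsIAST) → Q.IsIAST

/-- Completeness of a DP processor. -/
def Processor.IsComplete (F : Processor C D X) : Prop :=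
  ∀ Q, Q.IsIAST → ∀ Q' ∈ F.proc Q, Q'.IsIAST

/-- The edges of the innermost `(P, S)`-dependency graph, whose set of nodes is `P`. -/
def DPProblem.DepEdge (Q : DPProblem C D X) (ρ₁ ρ₂ : CoupledDT C D X) : Prop :=
  ρ₁ ∈ Q.P ∧ ρ₂ ∈ Q.P ∧
    ∃ (σ₁ σ₂ : X → ETerm C D X), ∃ q ∈ ρ₁.rhs, ∃ t ∈ q.2.1,
      Relation.ReflTransGen (InnermostRewrites (np Q.S)) (t.subst σ₁) (ρ₂.lhsSharp.subst σ₂) ∧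
      ρ₁.lhsSharp.subst σ₁ ∈ NF Q.S ∧ ρ₂.lhsSharp.subst σ₂ ∈ NF Q.S

/-- `Y` is a cycle of the dependency graph: a non-empty set of nodes such that there is a
non-empty path inside `Y` from any element to any element. -/
def DPProblem.IsCycle (Q : DPProblem C D X) (Y : Set (CoupledDT C D X)) : Prop :=
  Y.Nonempty ∧ Y ⊆ Q.P ∧
    ∀ a ∈ Y, ∀ b ∈ Y, Relation.TransGen (fun x y => x ∈ Y ∧ y ∈ Y ∧ Q.DepEdge x y) a b

/-- `Y` is an SCC of the dependency graph, i.e. a maximal cycle. -/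
def DPProblem.IsSCC (Q : DPProblem C D X) (Y : Set (CoupledDT C D X)) : Prop :=
  Maximal Q.IsCycle Y

lemma DPProblem.IsSCC.subset {Q : DPProblem C D X} {Y : Set (CoupledDT C D X)}
    (h : Q.IsSCC Y) : Y ⊆ Q.P := h.prop.2.1

/-- The dependency graph processor, which maps `(P, S)` to `{(P₁, S), …, (Pₙ, S)}` for the SCCs
`P₁, …, Pₙ` of the `(P, S)`-dependency graph. -/
def depGraphProcessor (C D : FirstOrder.Language.{u, v}) (X : Type w) : Processor C D X where
  proc Q := {Q' | ∃ (Y : Set (CoupledDT C D X)) (hY : Q.IsSCC Y), Q' = Q.restrict Y hY.subset}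
  finite_proc Q := by
    refine Set.Finite.of_finite_image (f := DPProblem.P)
      (Q.isPPTRS.1.finite_subsets.subset ?_) ?_
    · rintro _ ⟨_, ⟨Y, hY, rfl⟩, rfl⟩
      exact hY.subset
    · rintro _ ⟨Y, hY, rfl⟩ _ ⟨Y', hY', rfl⟩ h
      exact DPProblem.ext h rfl

end ProbDP

/-! Soundness is proved for strategies instead of trees. `Below` is inductive, so only
well-foundedly many inner steps precede each outer step; `Val` is the greatest fixed point built on
it, so outer steps may go on forever. A chain tree induces a strategy with the same termination
probability (`ChainTree.val_root`), and a strategy unfolds to a chain tree that terminates with at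
most its bound (`exists_chainTree`). Hence iAST is equivalent to `AST`: no strategy has a bound
below 1.

The core, `DPProblem.ast_of_isSCC`, peels off components of the dependency graph, by induction on
the size of a successor-closed set `P`. A source component `Y` receives no edge from `P \ Y`. It is
AST by hypothesis if it is an SCC; otherwise it is a single node on no cycle, and every step with it
lowers the number of terms that can still be used (`AST.of_noEdge_self`). The rest `P \ Y` is AST by
induction. Two facts combine these.

Since `P \ Y` alone is AST, a strategy for `P` can be cut off, raising its bound by an arbitrarily
small amount, so that only well-foundedly many steps with `S` and `P \ Y` occur between steps with
`Y` (`Val.partition`).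

Steps with `P \ Y` create only terms that never become redexes of `Y`. After such dead terms are
deleted, a step with `P \ Y` is a mere `S`-step on the other terms, or nothing at all. What remains
is a strategy for `Y` with the same bound, which is therefore at least 1 (`AST.of_noEdge`).

Completeness holds because a chain tree for a subset of the dependency tuples is also one for the
whole set. -/

namespace ProbDP

/-! ### Values of strategies -/

section Value

variable {A : Type*}

/-- The expected value of `f`. -/
noncomputable def expect (ν : Multiset (ℝ × A)) (f : A → ℝ) : ℝ :=
  (ν.map fun q => q.1 * f q.2).sum

/-- From `a`, a strategy that makes only well-foundedly many steps with `R₁` before it stops or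
makes a step with `R₂` into `H` terminates with probability at most `r`, where the pairs in `H`
are considered as bounds of the termination probability. -/
inductive Below (R₁ R₂ : A → Multiset (ℝ × A) → Prop) (H : A → ℝ → Prop) : A → ℝ → Prop
  | halt (a : A) (r : ℝ) (h : 1 ≤ r) : Below R₁ R₂ H a r
  | inner (a : A) (r : ℝ) (ν : Multiset (ℝ × A)) (f : A → ℝ) (hν : R₁ a ν)
      (h : ∀ q ∈ ν, Below R₁ R₂ H q.2 (f q.2)) (hr : expect ν f ≤ r) : Below R₁ R₂ H a r
  | outer (a : A) (r : ℝ) (ν : Multiset (ℝ × A)) (f : A → ℝ) (hν : R₂ a ν)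
      (h : ∀ q ∈ ν, H q.2 (f q.2)) (hr : expect ν f ≤ r) : Below R₁ R₂ H a r

/-- Some strategy with steps from `R₁` and `R₂` that uses `R₂` infinitely often on all infinite
paths terminates from `a` with probability at most `r`. -/
def Val (R₁ R₂ : A → Multiset (ℝ × A) → Prop) (a : A) (r : ℝ) : Prop :=
  ∃ H : A → ℝ → Prop, (∀ b s, H b s → 0 ≤ s ∧ Below R₁ R₂ H b s) ∧ H a r

/-- All strategies terminate almost surely. -/
def AST (R₁ R₂ : A → Multiset (ℝ × A) → Prop) : Prop :=
  ∀ a r, Val R₁ R₂ a r → 1 ≤ r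

/-- All steps lead to multi-distributions. -/
def Proper (R : A → Multiset (ℝ × A) → Prop) : Prop := ∀ a ν, R a ν → IsMultiDist ν

variable {R₁ R₂ R₃ : A → Multiset (ℝ × A) → Prop} {H H' : A → ℝ → Prop} {a : A} {r s : ℝ}

lemma Below.mono (h : Below R₁ R₂ H a r) (hH : ∀ b s, H b s → H' b s) :
    Below R₁ R₂ H' a r := by
  induction h with
  | halt a r h => exact .halt a r h
  | inner a r ν f hν _ hr ih => exact .inner a r ν f hν ih hr
  | outer a r ν f hν h hr => exact .outer a r ν f hν (fun q hq => hH _ _ (h q hq)) hr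

lemma Below.of_le (h : Below R₁ R₂ H a r) (hs : r ≤ s) : Below R₁ R₂ H a s := by
  cases h with
  | halt _ _ h => exact .halt a s (h.trans hs)
  | inner _ _ ν f hν h hr => exact .inner a s ν f hν h (hr.trans hs)
  | outer _ _ ν f hν h hr => exact .outer a s ν f hν h (hr.trans hs)

lemma Val.nonneg (h : Val R₁ R₂ a r) : 0 ≤ r := by
  obtain ⟨H, hH, ha⟩ := h
  exact (hH _ _ ha).1

/-- Knaster–Tarski: `Below` is monotone in `H`, so the union of all consistent `H` is again
consistent and `Val` can serve as its own `H`. -/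
lemma Val.below (h : Val R₁ R₂ a r) : Below R₁ R₂ (Val R₁ R₂) a r := by
  obtain ⟨H, hH, ha⟩ := h
  exact (hH _ _ ha).2.mono fun b s hb => ⟨H, hH, hb⟩

lemma expect_mono {ν : Multiset (ℝ × A)} {f g : A → ℝ} (hν : IsMultiDist ν)
    (h : ∀ q ∈ ν, f q.2 ≤ g q.2) : expect ν f ≤ expect ν g :=
  Multiset.sum_map_le_sum_map _ _ fun q hq =>
    mul_le_mul_of_nonneg_left (h q hq) (hν.1 q hq).1.le

lemma expect_nonneg {ν : Multiset (ℝ × A)} {f : A → ℝ} (hν : IsMultiDist ν)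
    (h : ∀ q ∈ ν, 0 ≤ f q.2) : 0 ≤ expect ν f :=
  Multiset.sum_nonneg fun x hx => by
    obtain ⟨q, hq, rfl⟩ := Multiset.mem_map.1 hx
    exact mul_nonneg (hν.1 q hq).1.le (h q hq)

lemma expect_add (ν : Multiset (ℝ × A)) (f g : A → ℝ) :
    expect ν (fun a => f a + g a) = expect ν f + expect ν g := by
  simp [expect, mul_add]

lemma expect_sub (ν : Multiset (ℝ × A)) (f g : A → ℝ) :
    expect ν (fun a => f a - g a) = expect ν f - expect ν g := by
  simp [expect, mul_sub]

lemma expect_const {ν : Multiset (ℝ × A)} (hν : IsMultiDist ν) (c : ℝ) :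
    expect ν (fun _ => c) = c := by
  have : expect ν (fun _ => c) = (ν.map Prod.fst).sum * c := by
    rw [expect, Multiset.sum_map_mul_right]
  rw [this, hν.2, one_mul]

/-- A function on labels that is minimal among the values of the objects with a label. -/
lemma exists_min_label {ι : Type*} (μ : Multiset ι) (b : ι → A) (s : ι → ℝ) :
    ∃ f : A → ℝ, ∀ i ∈ μ, f (b i) ≤ s i ∧ ∃ j ∈ μ, b j = b i ∧ s j = f (b i) := by
  classical
  have key : ∀ c : A, ∃ m : ℝ, ∀ i ∈ μ, b i = c → m ≤ s i ∧ ∃ j ∈ μ, b j = c ∧ s j = m := by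
    intro c
    by_cases hc : ∃ i ∈ μ, b i = c
    · obtain ⟨i, hi, hic⟩ := hc
      obtain ⟨j, hj, hmin⟩ := Finset.exists_min_image (μ.toFinset.filter fun i => b i = c) s
        ⟨i, by simp [hi, hic]⟩
      simp only [Finset.mem_filter, Multiset.mem_toFinset] at hj hmin
      exact ⟨s j, fun k hk hkc => ⟨hmin k ⟨hk, hkc⟩, j, hj.1, hj.2, rfl⟩⟩
    · exact ⟨0, fun i hi hic => (hc ⟨i, hi, hic⟩).elim⟩
  choose f hf using key
  exact ⟨f, fun i hi => hf (b i) i hi rfl⟩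

/-! ### Branchings indexed by an arbitrary multiset -/

section Indexed

variable {ι : Type*} {μ : Multiset ι} {p : ι → ℝ} {b : ι → A} {t : ι → ℝ}

/-- `Below` wants bounds that depend only on the object reached, whereas two branches may reach the
same object with different bounds. Choosing the least bound for each object only lowers the
expectation, as the weights are positive. -/
lemma Below.inner_of_index (h₁ : Proper R₁) (hμ : R₁ a (μ.map fun i => (p i, b i)))
    (h : ∀ i ∈ μ, Below R₁ R₂ H (b i) (t i)) (hr : (μ.map fun i => p i * t i).sum ≤ r) :
    Below R₁ R₂ H a r := by
  obtain ⟨f, hf⟩ := exists_min_label μ b t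
  refine .inner a r _ f hμ ?_ (le_trans ?_ hr)
  · intro q hq
    obtain ⟨i, hi, rfl⟩ := Multiset.mem_map.1 hq
    obtain ⟨j, hj, hji, hjt⟩ := (hf i hi).2
    have := h j hj
    rwa [hji, hjt] at this
  · rw [expect, Multiset.map_map]
    refine Multiset.sum_map_le_sum_map _ _ fun i hi => ?_
    exact mul_le_mul_of_nonneg_left (hf i hi).1
      ((h₁ _ _ hμ).1 (p i, b i) (Multiset.mem_map.2 ⟨i, hi, rfl⟩)).1.le

lemma Below.outer_of_index (h₂ : Proper R₂) (hμ : R₂ a (μ.map fun i => (p i, b i)))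
    (h : ∀ i ∈ μ, H (b i) (t i)) (hr : (μ.map fun i => p i * t i).sum ≤ r) :
    Below R₁ R₂ H a r := by
  obtain ⟨f, hf⟩ := exists_min_label μ b t
  refine .outer a r _ f hμ ?_ (le_trans ?_ hr)
  · intro q hq
    obtain ⟨i, hi, rfl⟩ := Multiset.mem_map.1 hq
    obtain ⟨j, hj, hji, hjt⟩ := (hf i hi).2
    have := h j hj
    rwa [hji, hjt] at this
  · rw [expect, Multiset.map_map]
    refine Multiset.sum_map_le_sum_map _ _ fun i hi => ?_
    exact mul_le_mul_of_nonneg_left (hf i hi).1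
      ((h₂ _ _ hμ).1 (p i, b i) (Multiset.mem_map.2 ⟨i, hi, rfl⟩)).1.le

/-- A probabilistic branching without an effect can be left out. -/
lemma Below.of_idle (hp : ∀ i ∈ μ, 0 ≤ p i) (hp1 : (μ.map p).sum = 1)
    (h : ∀ i ∈ μ, Below R₁ R₂ H a (t i)) (hr : (μ.map fun i => p i * t i).sum ≤ r) :
    Below R₁ R₂ H a r := by
  -- If the bound `r` failed, every `t i` would exceed `r`; but a weighted average of the `t i` with
  -- total weight 1 is at most `r`.
  by_contra hcon
  have hlt : ∀ i ∈ μ, r < t i := fun i hi => not_le.1 fun hle => hcon ((h i hi).of_le hle)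
  have h0 : (μ.map fun i => p i * (t i - r)).sum ≤ 0 := by
    simp only [mul_sub, Multiset.sum_map_sub, Multiset.sum_map_mul_right, hp1]
    linarith
  have h1 : ∀ i ∈ μ, p i = 0 := by
    intro i hi
    have hnn : ∀ x ∈ μ.map fun i => p i * (t i - r), 0 ≤ x := by
      intro x hx
      obtain ⟨j, hj, rfl⟩ := Multiset.mem_map.1 hx
      exact mul_nonneg (hp j hj) (sub_nonneg.2 (hlt j hj).le)
    have := (Multiset.single_le_sum hnn _ (Multiset.mem_map.2 ⟨i, hi, rfl⟩)).trans h0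
    have h2 := sub_pos.2 (hlt i hi)
    exact le_antisymm (nonpos_of_mul_nonpos_left this h2) (hp i hi)
  rw [Multiset.map_congr rfl h1] at hp1
  simp at hp1

end Indexed

/-- If the strategies with `R₁` and `R₂` terminate almost surely, then one can restrict oneself to
strategies which use `R₃` infinitely often on all infinite paths. -/
theorem Val.partition (h₁ : Proper R₁) (h₂ : Proper R₂) (h₃ : Proper R₃) (hast : AST R₁ R₂)
    (hv : Val R₁ (fun a ν => R₂ a ν ∨ R₃ a ν) a s) (hs : s < r) :
    Val (fun a ν => R₁ a ν ∨ R₂ a ν) R₃ a r := by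
  set V := Val R₁ (fun a ν => R₂ a ν ∨ R₃ a ν) with hV
  -- The strict inequality leaves room for the infimum `g` below, which need not be attained.
  set H : A → ℝ → Prop := fun b t => ∃ s < t, V b s with hH
  set B := Below (fun a ν => R₁ a ν ∨ R₂ a ν) R₃ H with hB
  set g : A → ℝ := fun b => sInf {t | 0 ≤ t ∧ B b t} with hg
  have hbdd : ∀ b, BddBelow {t | 0 ≤ t ∧ B b t} := fun b => ⟨0, fun t ht => ht.1⟩
  have hne : ∀ b, {t | 0 ≤ t ∧ B b t}.Nonempty := fun b => ⟨1, zero_le_one, .halt b 1 le_rfl⟩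
  have g_le : ∀ b t, 0 ≤ t → B b t → g b ≤ t := fun b t h0 ht => csInf_le (hbdd b) ⟨h0, ht⟩
  have g_one : ∀ b, g b ≤ 1 := fun b => g_le b 1 zero_le_one (.halt b 1 le_rfl)
  have g_nonneg : ∀ b, 0 ≤ g b := fun b => le_csInf (hne b) fun t ht => ht.1
  have B_of_lt : ∀ b t, g b < t → B b t := by
    intro b t ht
    obtain ⟨t', ⟨-, h'⟩, hlt⟩ := exists_lt_of_csInf_lt (hne b) ht
    exact h'.of_le hlt.le
  have g_step : ∀ b ν, R₁ b ν ∨ R₂ b ν → g b ≤ expect ν g := by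
    intro b ν hν
    have hd : IsMultiDist ν := hν.elim (h₁ _ _) (h₂ _ _)
    refine le_of_forall_pos_le_add fun ε hε => ?_
    have he : expect ν (fun c => g c + ε) = expect ν g + ε := by
      rw [expect_add, expect_const hd]
    refine g_le _ _ (add_nonneg (expect_nonneg hd fun q _ => g_nonneg _) hε.le) ?_
    exact .inner b _ ν (fun c => g c + ε) hν (fun q _ => B_of_lt _ _ (by simpa using hε)) he.le
  have g_outer : ∀ b ν f, R₃ b ν → (∀ q ∈ ν, V q.2 (f q.2)) → g b ≤ expect ν f := by
    intro b ν f hν hf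
    have hd := h₃ _ _ hν
    refine le_of_forall_pos_le_add fun ε hε => ?_
    have he : expect ν (fun c => f c + ε) = expect ν f + ε := by
      rw [expect_add, expect_const hd]
    refine g_le _ _ (add_nonneg (expect_nonneg hd fun q hq => (hf q hq).nonneg) hε.le) ?_
    exact .outer b _ ν (fun c => f c + ε) hν (fun q hq => ⟨f q.2, by simpa using hε, hf q hq⟩) he.le
  -- The goal is `g b ≤ s` whenever `V b s`. The shifted bound `1 - g b + s` is a legitimate one for
  -- `R₁` and `R₂`: the shift survives their steps because `g` is at most its expectation there, and
  -- at an `R₃`-step `g b ≤ s` makes the bound at least 1, so the strategy may halt. Almost-sure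
  -- termination then gives `1 ≤ 1 - g b + s`.
  set K : A → ℝ → Prop := fun b u => ∃ s, V b s ∧ u = 1 - g b + s with hK
  have exp_K : ∀ ν f, IsMultiDist ν →
      expect ν (fun c => 1 - g c + f c) = 1 - expect ν g + expect ν f := by
    intro ν f hd
    rw [expect_add, expect_sub, expect_const hd]
  have key : ∀ b s, Below R₁ (fun a ν => R₂ a ν ∨ R₃ a ν) V b s →
      Below R₁ R₂ K b (1 - g b + s) := by
    intro b s hb
    induction hb with
    | halt b s h => exact .halt _ _ (by linarith [g_one b])
    | inner b s ν f hν _ hr ih =>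
      refine .inner _ _ ν (fun c => 1 - g c + f c) hν ih ?_
      rw [exp_K ν f (h₁ _ _ hν)]
      linarith [g_step b ν (.inl hν)]
    | outer b s ν f hν h hr =>
      rcases hν with hν | hν
      · refine .outer _ _ ν (fun c => 1 - g c + f c) hν (fun q hq => ⟨_, h q hq, rfl⟩) ?_
        rw [exp_K ν f (h₂ _ _ hν)]
        linarith [g_step b ν (.inr hν)]
      · exact .halt _ _ (by linarith [g_outer b ν f hν h])
  have g_le_V : ∀ b s, V b s → g b ≤ s := by
    intro b s hb
    have := hast b (1 - g b + s) ⟨K, ?_, s, hb, rfl⟩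
    · linarith
    · rintro c _ ⟨s', hc, rfl⟩
      exact ⟨by linarith [g_one c, hc.nonneg], key c s' hc.below⟩
  refine ⟨H, ?_, s, hs, hv⟩
  rintro b t ⟨s', hst, hb⟩
  exact ⟨hb.nonneg.trans hst.le, B_of_lt b t ((g_le_V b s' hb).trans_lt hst)⟩

end Value

variable {C D : FirstOrder.Language.{u, v}} {X : Type w}

/-! ### Chain trees and strategies -/

lemma IsMultiDist.map_snd {A B : Type*} {μ : Multiset (ℝ × A)} (h : IsMultiDist μ)
    (f : ℝ × A → B) : IsMultiDist (μ.map fun q => (q.1, f q)) := by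
  refine ⟨fun q hq => ?_, ?_⟩
  · obtain ⟨q', hq', rfl⟩ := Multiset.mem_map.1 hq
    exact h.1 q' hq'
  · rw [Multiset.map_map]
    exact h.2

lemma IsMultiDist.ne_zero {A : Type*} {μ : Multiset (ℝ × A)} (h : IsMultiDist μ) : μ ≠ 0 := by
  rintro rfl
  simpa using h.2

lemma IsPPTRS.isMultiDist {P : Set (CoupledDT C D X)} (hP : IsPPTRS P) {ρ : CoupledDT C D X}
    (hρ : ρ ∈ P) : IsMultiDist ρ.rhs := by
  have h : IsMultiDist ρ.proj₂.rhs := (hP.2.1.2 _ ⟨ρ, hρ, rfl⟩).1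
  refine ⟨fun q hq => h.1 (q.1, q.2.2) (Multiset.mem_map.2 ⟨q, hq, rfl⟩), ?_⟩
  have := h.2
  rwa [CoupledDT.proj₂, Multiset.map_map] at this

lemma IsPTRS.proper_stepS {S : Set (PRule C D X)} (hS : IsPTRS S) : Proper (StepS S) := by
  rintro a ν ⟨ρ, hρ, σ, s, π, rest, -, -, -, -, rfl⟩
  exact (hS.2 ρ hρ).1.map_snd _

lemma IsPPTRS.proper_stepPS {P : Set (CoupledDT C D X)} (hP : IsPPTRS P)
    (S : Set (PRule C D X)) : Proper (StepPS P S) := by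
  rintro a ν ⟨ρ, hρ, σ, rest, -, -, -, rfl⟩
  exact (hP.isMultiDist hρ).map_snd _

namespace ChainTree

variable {Q : DPProblem C D X} (T : ChainTree Q)

/-- The children of a node. -/
noncomputable def children (x : T.Node) : Finset T.Node := (T.finite_succ x).toFinset

@[simp] lemma mem_children {x y : T.Node} : y ∈ T.children x ↔ T.Edge x y := by
  simp [children]

/-- The multi-distribution given by the children of a node. -/
noncomputable def childDist (x : T.Node) : Multiset (ℝ × Compound C D X) :=
  (T.children x).val.map fun y => (T.prob y / T.prob x, T.term y)

lemma step {x y : T.Node} (h : T.Edge x y) :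
    (x ∈ T.PNode ∧ StepPS Q.P Q.S (T.term x) (T.childDist x)) ∨
      (x ∉ T.PNode ∧ StepS Q.S (T.term x) (T.childDist x)) := by
  by_cases hx : x ∈ T.PNode
  · exact .inl ⟨hx, T.stepP x hx⟩
  · exact .inr ⟨hx, T.stepS x hx ⟨y, h⟩⟩

lemma sum_children_prob {x y : T.Node} (h : T.Edge x y) :
    ∑ z ∈ T.children x, T.prob z = T.prob x := by
  have hd : IsMultiDist (T.childDist x) := by
    rcases T.step h with h | h
    · exact Q.isPPTRS.proper_stepPS _ _ _ h.2
    · exact Q.isPTRS.proper_stepS _ _ h.2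
  have h1 := hd.2
  rw [childDist, Multiset.map_map] at h1
  have h2 : ∑ z ∈ T.children x, T.prob z / T.prob x = 1 := h1
  rwa [← Finset.sum_div, div_eq_one_iff_eq (T.prob_pos x).ne'] at h2

open Classical in
/-- The leaves below a node of relative depth at most `n`. -/
noncomputable def leavesBelow : ℕ → T.Node → Finset T.Node
  | 0, x => if x ∈ T.Leaf then {x} else ∅
  | n + 1, x => if x ∈ T.Leaf then {x} else (T.children x).biUnion (leavesBelow n)

lemma exists_mem_leavesBelow {x y : T.Node} (h : Relation.ReflTransGen T.Edge x y)
    (hy : y ∈ T.Leaf) : ∃ n, ∀ m, n ≤ m → y ∈ T.leavesBelow m x := by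
  induction h using Relation.ReflTransGen.head_induction_on with
  | refl => exact ⟨0, fun m _ => by cases m <;> simp [leavesBelow, hy]⟩
  | @head x z hxz _ ih =>
    obtain ⟨n, hn⟩ := ih
    refine ⟨n + 1, fun m hm => ?_⟩
    obtain ⟨m, rfl⟩ : ∃ k, m = k + 1 := ⟨m - 1, by omega⟩
    have hx : x ∉ T.Leaf := fun hx => hx z hxz
    simp only [leavesBelow, hx, if_false, Finset.mem_biUnion, mem_children]
    exact ⟨z, hxz, hn m (by omega)⟩

lemma sum_biUnion_le_sum {ι β : Type*} [DecidableEq β] (s : Finset ι) (t : ι → Finset β)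
    (f : β → ENNReal) : ∑ y ∈ s.biUnion t, f y ≤ ∑ i ∈ s, ∑ y ∈ t i, f y := by
  classical
  induction s using Finset.induction_on with
  | empty => simp
  | insert i s hi ih =>
    rw [Finset.biUnion_insert, Finset.sum_insert hi]
    refine le_trans ?_ (add_le_add_right ih _)
    rw [← Finset.sum_union_inter]
    exact le_self_add

/-- A superharmonic function bounds the probability of termination. -/
lemma leafProb_le (g : T.Node → ENNReal)
    (hleaf : ∀ x ∈ T.Leaf, ENNReal.ofReal (T.prob x) ≤ g x)
    (hstep : ∀ x, x ∉ T.Leaf → ∑ y ∈ T.children x, g y ≤ g x) : T.leafProb ≤ g T.root := by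
  classical
  have key : ∀ n x, ∑ y ∈ T.leavesBelow n x, ENNReal.ofReal (T.prob y) ≤ g x := by
    intro n
    induction n with
    | zero =>
      intro x
      by_cases hx : x ∈ T.Leaf
      · simpa [leavesBelow, hx] using hleaf x hx
      · simp [leavesBelow, hx]
    | succ n ih =>
      intro x
      by_cases hx : x ∈ T.Leaf
      · simpa [leavesBelow, hx] using hleaf x hx
      · simp only [leavesBelow, hx, if_false]
        exact (sum_biUnion_le_sum _ _ _).trans
          ((Finset.sum_le_sum fun y _ => ih y).trans (hstep x hx))
  rw [leafProb, ENNReal.tsum_eq_iSup_sum]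
  -- A finite set of leaves lies within some finite depth, where `key` applies.
  refine iSup_le fun F => ?_
  choose n hn using fun x : T.Leaf => T.exists_mem_leavesBelow (T.reachable x) x.2
  refine le_trans ?_ (key (F.sup n) T.root)
  refine (Finset.sum_map F (Function.Embedding.subtype (· ∈ T.Leaf))
    fun x => ENNReal.ofReal (T.prob x)).symm.trans_le ?_
  refine Finset.sum_le_sum_of_subset fun y hy => ?_
  obtain ⟨x, hx, rfl⟩ := Finset.mem_map.1 hy
  exact hn x _ (Finset.le_sup hx)

lemma exists_edge_of_notMem_leaf {x : T.Node} (hx : x ∉ T.Leaf) : ∃ y, T.Edge x y := by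
  simpa [Leaf] using hx

lemma leafProb_le_one : T.leafProb ≤ 1 := by
  have := T.leafProb_le (fun x => ENNReal.ofReal (T.prob x)) (fun _ _ => le_rfl) ?_
  · simpa [T.prob_root] using this
  · intro x hx
    obtain ⟨y, hy⟩ := T.exists_edge_of_notMem_leaf hx
    rw [← ENNReal.ofReal_sum_of_nonneg fun z _ => (T.prob_pos z).le, T.sum_children_prob hy]

/-- As predecessors are unique, a cycle through a node also passes through its parent, and so on up
to the root, which has no predecessor. -/
lemma no_cycle (x : T.Node) : ¬ Relation.TransGen T.Edge x x := by
  have key : ∀ y, Relation.ReflTransGen T.Edge T.root y → ¬ Relation.TransGen T.Edge y y := by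
    intro y hy
    induction hy with
    | refl =>
      intro h
      obtain ⟨z, -, hz⟩ := Relation.TransGen.tail'_iff.1 h
      exact T.root_no_pred z hz
    | @tail y z _ hyz ih =>
      intro h
      obtain ⟨z', hz', hz⟩ := Relation.TransGen.tail'_iff.1 h
      obtain rfl := T.pred_unique _ _ _ hyz hz
      exact ih (Relation.TransGen.head' hyz hz')
  exact key x (T.reachable x)

/-- Two nodes above the same node are comparable. -/
lemma comparable {x y z : T.Node} (hx : Relation.ReflTransGen T.Edge x z)
    (hy : Relation.ReflTransGen T.Edge y z) :
    Relation.ReflTransGen T.Edge x y ∨ Relation.ReflTransGen T.Edge y x := by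
  induction hx with
  | refl => exact .inr hy
  | @tail w z hxw hwz ih =>
    rcases Relation.ReflTransGen.cases_tail hy with rfl | ⟨w', hyw', hw'z⟩
    · exact .inl (hxw.tail hwz)
    · obtain rfl := T.pred_unique _ _ _ hwz hw'z
      exact ih hyw'

/-- Subtrees of distinct children are disjoint, so that `sum_leafMass_le` counts each leaf for at
most one child. -/
lemma child_unique {x y y' z : T.Node} (hy : T.Edge x y) (hy' : T.Edge x y')
    (hz : Relation.ReflTransGen T.Edge y z) (hz' : Relation.ReflTransGen T.Edge y' z) :
    y = y' := by
  have aux : ∀ {y y'}, T.Edge x y → T.Edge x y' → Relation.ReflTransGen T.Edge y y' → y = y' := by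
    intro y y' hy hy' h
    rcases Relation.ReflTransGen.cases_tail h with rfl | ⟨w, hyw, hw⟩
    · rfl
    · obtain rfl := T.pred_unique _ _ _ hy' hw
      exact (T.no_cycle _ (Relation.TransGen.head' hy hyw)).elim
  rcases T.comparable hz hz' with h | h
  · exact aux hy hy' h
  · exact (aux hy' hy h).symm

open Classical in
/-- The sum of the probabilities of the leaves below a node. -/
noncomputable def leafMass (x : T.Node) : ENNReal :=
  ∑' z : T.Leaf, if Relation.ReflTransGen T.Edge x z then ENNReal.ofReal (T.prob z) else 0

lemma leafMass_root : T.leafMass T.root = T.leafProb := by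
  simp [leafMass, leafProb, T.reachable]

lemma leafMass_ne_top (x : T.Node) : T.leafMass x ≠ ⊤ := by
  refine ne_top_of_le_ne_top ENNReal.one_ne_top (le_trans ?_ T.leafProb_le_one)
  refine ENNReal.tsum_le_tsum fun z => ?_
  split_ifs <;> simp

lemma le_leafMass_of_mem_leaf {x : T.Node} (hx : x ∈ T.Leaf) :
    ENNReal.ofReal (T.prob x) ≤ T.leafMass x := by
  refine le_trans ?_ (ENNReal.le_tsum (⟨x, hx⟩ : T.Leaf))
  simp [Relation.ReflTransGen.refl]

lemma sum_leafMass_le (x : T.Node) : ∑ y ∈ T.children x, T.leafMass y ≤ T.leafMass x := by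
  classical
  unfold leafMass
  rw [← Summable.tsum_finsetSum fun _ _ => ENNReal.summable]
  refine ENNReal.tsum_le_tsum fun z => ?_
  by_cases h : ∃ y, T.Edge x y ∧ Relation.ReflTransGen T.Edge y z
  · obtain ⟨y, hxy, hyz⟩ := h
    rw [if_pos (Relation.ReflTransGen.head hxy hyz), Finset.sum_eq_single y]
    · rw [if_pos hyz]
    · intro y' hy' hne
      rw [if_neg fun h => hne (T.child_unique (T.mem_children.1 hy') hxy h hyz)]
    · intro h
      exact (h (T.mem_children.2 hxy)).elim
  · rw [Finset.sum_eq_zero]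
    · exact zero_le
    · intro y hy
      rw [if_neg fun hyz => h ⟨y, T.mem_children.1 hy, hyz⟩]

/-- An infinite descending chain would be an infinite path avoiding `PNode`. This turns the
condition on infinite paths into the induction needed for `Below`. -/
lemma wf_inner : WellFounded fun y x => x ∉ T.PNode ∧ T.Edge x y := by
  rw [wellFounded_iff_isEmpty_descending_chain]
  refine ⟨fun ⟨path, h⟩ => ?_⟩
  refine T.infinite_PNode path (fun n => (h n).2) ?_
  convert Set.finite_empty
  ext n
  simpa using (h n).1

/-- A chain tree yields a strategy with the same probability of termination. -/
lemma val_root : Val (StepS Q.S) (StepPS Q.P Q.S) (T.term T.root) T.leafProb.toReal := by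
  -- The probability of termination conditional on having reached `x`.
  set h : T.Node → ℝ := fun x => (T.leafMass x).toReal / T.prob x with hh
  have h_sum : ∀ x, ((T.children x).val.map fun y => T.prob y / T.prob x * h y).sum ≤ h x := by
    intro x
    have h1 : ∀ y, T.prob y / T.prob x * h y = (T.leafMass y).toReal / T.prob x := by
      intro y
      have := (T.prob_pos y).ne'
      simp only [hh]
      field_simp
    simp only [h1]
    change ∑ y ∈ T.children x, (T.leafMass y).toReal / T.prob x ≤ _
    rw [← Finset.sum_div, ← ENNReal.toReal_sum fun y _ => T.leafMass_ne_top y]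
    exact div_le_div_of_nonneg_right
      (ENNReal.toReal_mono (T.leafMass_ne_top x) (T.sum_leafMass_le x)) (T.prob_pos x).le
  refine ⟨fun a r => ∃ x, a = T.term x ∧ r = h x, ?_, T.root, rfl, ?_⟩
  · rintro _ _ ⟨x, rfl, rfl⟩
    refine ⟨div_nonneg ENNReal.toReal_nonneg (T.prob_pos x).le, ?_⟩
    induction x using T.wf_inner.induction with
    | _ x ih =>
    by_cases hx : x ∈ T.Leaf
    · refine .halt _ _ ?_
      rw [hh, one_le_div (T.prob_pos x), ← ENNReal.toReal_ofReal (T.prob_pos x).le]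
      exact ENNReal.toReal_mono (T.leafMass_ne_top x) (T.le_leafMass_of_mem_leaf hx)
    · obtain ⟨y, hy⟩ := T.exists_edge_of_notMem_leaf hx
      rcases T.step hy with ⟨-, hs⟩ | ⟨hP, hs⟩
      · exact .outer_of_index (Q.isPPTRS.proper_stepPS _) hs (fun z _ => ⟨z, rfl, rfl⟩) (h_sum x)
      · exact .inner_of_index Q.isPTRS.proper_stepS hs
          (fun z hz => ih z ⟨hP, T.mem_children.1 hz⟩) (h_sum x)
  · simp [hh, T.prob_root, T.leafMass_root]

end ChainTree

lemma DPProblem.isIAST_of_ast {Q : DPProblem C D X}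
    (h : AST (StepS Q.S) (StepPS Q.P Q.S)) : Q.IsIAST := by
  intro T
  have h1 := h _ _ T.val_root
  refine le_antisymm T.leafProb_le_one ?_
  have hne : T.leafProb ≠ ⊤ := ne_top_of_le_ne_top ENNReal.one_ne_top T.leafProb_le_one
  rwa [← ENNReal.toReal_le_toReal ENNReal.one_ne_top hne, ENNReal.toReal_one]

/-! ### Unfolding of a strategy to a chain tree -/

section Unfold

variable {W : Type*} (succ : W → List (ℝ × W)) (w₀ : W)

/-- The probability and the state that are reached by a sequence of choices (the last choice is
the head of the list). -/
def stateAt : List ℕ → Option (ℝ × W)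
  | [] => some (1, w₀)
  | i :: l => (stateAt l).bind fun x => ((succ x.2)[i]?).map fun q => (x.1 * q.1, q.2)

/-- The nodes of the unfolding. -/
def UNode : Type := {l : List ℕ // (stateAt succ w₀ l).isSome}

namespace UNode

variable {succ w₀}

/-- The probability and the state of a node. -/
def val (x : UNode succ w₀) : ℝ × W := (stateAt succ w₀ x.1).get x.2

lemma stateAt_eq (x : UNode succ w₀) : stateAt succ w₀ x.1 = some x.val := by
  simp [val]

/-- The root. -/
def root : UNode succ w₀ := ⟨[], rfl⟩

lemma val_root : (root : UNode succ w₀).val = (1, w₀) := rfl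

lemma stateAt_cons (x : UNode succ w₀) (i : ℕ) : stateAt succ w₀ (i :: x.1) =
    ((succ x.val.2)[i]?).map fun q => (x.val.1 * q.1, q.2) := by
  rw [stateAt, x.stateAt_eq, Option.bind_some]

/-- The `i`-th child. -/
def child (x : UNode succ w₀) (i : Fin (succ x.val.2).length) : UNode succ w₀ :=
  ⟨i.1 :: x.1, by rw [x.stateAt_cons]; simp⟩

lemma val_child (x : UNode succ w₀) (i : Fin (succ x.val.2).length) :
    (x.child i).val = (x.val.1 * ((succ x.val.2).get i).1, ((succ x.val.2).get i).2) := by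
  have h := (x.child i).stateAt_eq
  have h' : stateAt succ w₀ (x.child i).1 = _ := x.stateAt_cons i
  rw [h'] at h
  simpa using h.symm

/-- The edges of the unfolding. -/
def Edge (x y : UNode succ w₀) : Prop := ∃ i, x.child i = y

lemma child_injective (x : UNode succ w₀) : Function.Injective x.child := by
  intro i j h
  have := congrArg Subtype.val h
  simp only [child, List.cons.injEq, and_true] at this
  exact Fin.ext this

lemma reachable (x : UNode succ w₀) : Relation.ReflTransGen Edge root x := by
  obtain ⟨l, hl⟩ := x
  induction l with
  | nil => exact .refl
  | cons i l ih =>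
    have hl' : (stateAt succ w₀ l).isSome := by
      rw [stateAt] at hl
      exact Option.isSome_of_isSome_bind hl
    refine (ih hl').tail ⟨⟨i, ?_⟩, rfl⟩
    rw [show stateAt succ w₀ (i :: l) = _ from UNode.stateAt_cons ⟨l, hl'⟩ i] at hl
    simpa using hl

lemma finite_edge (x : UNode succ w₀) : {y | Edge x y}.Finite := Set.finite_range x.child

lemma children_map {B : Type*} (x : UNode succ w₀) (F : ℝ × W → B) :
    (x.finite_edge.toFinset.val.map fun y => F y.val) =
      ((succ x.val.2).map fun q => F (x.val.1 * q.1, q.2) : List B) := by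
  have h : x.finite_edge.toFinset = Finset.univ.map ⟨x.child, x.child_injective⟩ := by
    ext y
    simp [Edge]
  rw [h, Finset.map_val, Multiset.map_map]
  simp only [Function.comp_def, Function.Embedding.coeFn_mk, val_child, Fin.univ_val_map]
  exact congrArg _ ((List.map_ofFn (f := (succ x.val.2).get)
    (g := fun q => F (x.val.1 * q.1, q.2))).symm.trans (by rw [List.ofFn_get]))

end UNode

/-- A strategy given by a (possibly infinite) transition system can be unfolded to a chain
tree. -/
lemma exists_chainTree {Q : DPProblem C D X} (lab : W → Compound C D X) (outer : Set W)
    (bound : W → ℝ)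
    (h_outer : ∀ w ∈ outer, StepPS Q.P Q.S (lab w)
      ((succ w).map fun q => (q.1, lab q.2) : List _))
    (h_inner : ∀ w, w ∉ outer → succ w ≠ [] → StepS Q.S (lab w)
      ((succ w).map fun q => (q.1, lab q.2) : List _))
    (h_wf : WellFounded fun w' w => w ∉ outer ∧ ∃ q ∈ succ w, q.2 = w')
    (h_nonneg : ∀ w, 0 ≤ bound w) (h_leaf : ∀ w, succ w = [] → 1 ≤ bound w)
    (h_step : ∀ w, succ w ≠ [] → ((succ w).map fun q => q.1 * bound q.2).sum ≤ bound w) :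
    ∃ T : ChainTree Q, T.leafProb ≤ ENNReal.ofReal (bound w₀) := by
  have h_dist : ∀ w, w ∈ outer ∨ succ w ≠ [] →
      IsMultiDist (A := Compound C D X) ((succ w).map fun q => (q.1, lab q.2) : List _) := by
    intro w hw
    by_cases ho : w ∈ outer
    · exact Q.isPPTRS.proper_stepPS _ _ _ (h_outer w ho)
    · exact Q.isPTRS.proper_stepS _ _ (h_inner w ho (hw.resolve_left ho))
  have h_prob : ∀ w, ∀ q ∈ succ w, 0 < q.1 ∧ q.1 ≤ 1 := fun w q hq =>
    (h_dist w (.inr (List.ne_nil_of_mem hq))).1 (q.1, lab q.2) (by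
      rw [Multiset.mem_coe]
      exact List.mem_map.2 ⟨q, hq, rfl⟩)
  have pos : ∀ x : UNode succ w₀, 0 < x.val.1 ∧ x.val.1 ≤ 1 := by
    intro x
    induction x.reachable with
    | refl => simp [UNode.val_root]
    | tail _ h ih =>
      obtain ⟨i, rfl⟩ := h
      have := h_prob _ _ (List.get_mem (succ _) i)
      rw [UNode.val_child]
      exact ⟨mul_pos ih.1 this.1, mul_le_one₀ ih.2 this.1.le this.2⟩
  have edge_ne : ∀ x : UNode succ w₀, (∃ y, UNode.Edge x y) ↔ succ x.val.2 ≠ [] := by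
    intro x
    rw [← List.length_pos_iff]
    exact ⟨fun ⟨y, i, _⟩ => i.pos, fun h => ⟨_, ⟨0, h⟩, rfl⟩⟩
  have child_dist : ∀ x : UNode succ w₀,
      (x.finite_edge.toFinset.val.map fun y => (y.val.1 / x.val.1, lab y.val.2)) =
        ((succ x.val.2).map fun q => (q.1, lab q.2) : List _) := by
    intro x
    rw [x.children_map fun q => (q.1 / x.val.1, lab q.2)]
    simp only [mul_div_cancel_left₀ _ (pos x).1.ne']
  let T : ChainTree Q :=
    { Node := UNode succ w₀
      Edge := UNode.Edge
      root := UNode.root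
      reachable := UNode.reachable
      root_no_pred := by
        rintro x ⟨i, h⟩
        have := congrArg Subtype.val h
        simp [UNode.child, UNode.root] at this
      pred_unique := by
        rintro x x' y ⟨i, rfl⟩ ⟨j, h⟩
        have := congrArg Subtype.val h
        simp only [UNode.child, List.cons.injEq] at this
        exact Subtype.ext this.2.symm
      finite_succ := UNode.finite_edge
      prob := fun x => x.val.1
      term := fun x => lab x.val.2
      prob_pos := fun x => (pos x).1
      prob_le_one := fun x => (pos x).2
      prob_root := rfl
      PNode := {x | x.val.2 ∈ outer}
      inner_of_PNode := fun x hx => by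
        refine (edge_ne x).2 fun h => (h_dist _ (.inl hx)).ne_zero ?_
        simp [h]
      stepP := fun x hx => by
        rw [child_dist]
        exact h_outer _ hx
      stepS := fun x hx h => by
        rw [child_dist]
        exact h_inner _ hx ((edge_ne x).1 h)
      infinite_PNode := by
        intro path hpath
        rw [← Nat.frequently_atTop_iff_infinite, Filter.frequently_atTop]
        intro N
        by_contra! hN
        refine (wellFounded_iff_isEmpty_descending_chain.1 h_wf).false
          ⟨fun n => (path (N + n)).val.2, fun n => ⟨hN (N + n) (by omega), ?_⟩⟩
        obtain ⟨i, hi⟩ := hpath (N + n)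
        refine ⟨_, List.get_mem _ i, ?_⟩
        change _ = (path (N + n + 1)).val.2
        rw [← hi, UNode.val_child] }
  refine ⟨T, ?_⟩
  -- The probability of a node times the bound of its state is superharmonic and dominates the
  -- probability at leaves.
  have h := T.leafProb_le (fun x : UNode succ w₀ => ENNReal.ofReal (x.val.1 * bound x.val.2))
    ?_ ?_
  · simpa [T, UNode.val_root] using h
  · intro (x : UNode succ w₀) hx
    have hs : succ x.val.2 = [] := by
      by_contra hs
      obtain ⟨y, hy⟩ := (edge_ne x).2 hs
      exact hx y hy
    exact ENNReal.ofReal_le_ofReal (le_mul_of_one_le_right (pos x).1.le (h_leaf _ hs))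
  · intro (x : UNode succ w₀) hx
    rw [← ENNReal.ofReal_sum_of_nonneg fun (z : UNode succ w₀) _ =>
      mul_nonneg (pos z).1.le (h_nonneg _)]
    refine ENNReal.ofReal_le_ofReal ?_
    have h1 := congrArg Multiset.sum (x.children_map fun q => q.1 * bound q.2)
    refine (le_of_eq h1).trans ?_
    simp only [Multiset.sum_coe, mul_assoc, List.sum_map_mul_left]
    exact mul_le_mul_of_nonneg_left
      (h_step _ ((edge_ne x).1 (T.exists_edge_of_notMem_leaf hx))) (pos x).1.le

end Unfold

/-! ### Strategies as transition systems -/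

section Strat

variable {A : Type*} {R₁ R₂ : A → Multiset (ℝ × A) → Prop} {H : A → ℝ → Prop}

/-- The derivations of `Below`. -/
inductive Strat (R₁ R₂ : A → Multiset (ℝ × A) → Prop) (H : A → ℝ → Prop) : A → ℝ → Type _
  | halt (a : A) (r : ℝ) (h : 1 ≤ r) : Strat R₁ R₂ H a r
  | inner (a : A) (r : ℝ) (ν : Multiset (ℝ × A)) (f : A → ℝ) (hν : R₁ a ν)
      (h : ∀ q ∈ ν, Strat R₁ R₂ H q.2 (f q.2)) (hr : expect ν f ≤ r) : Strat R₁ R₂ H a r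
  | outer (a : A) (r : ℝ) (ν : Multiset (ℝ × A)) (f : A → ℝ) (hν : R₂ a ν)
      (h : ∀ q ∈ ν, H q.2 (f q.2)) (hr : expect ν f ≤ r) : Strat R₁ R₂ H a r

/-- A proof of `Below` is a proposition, from which no next move can be extracted as data; the
`Type`-valued copy makes it possible to define successor states. -/
lemma Below.nonempty_strat {a : A} {r : ℝ} (h : Below R₁ R₂ H a r) :
    Nonempty (Strat R₁ R₂ H a r) := by
  induction h with
  | halt a r h => exact ⟨.halt a r h⟩
  | inner a r ν f hν _ hr ih => exact ⟨.inner a r ν f hν (fun q hq => (ih q hq).some) hr⟩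
  | outer a r ν f hν h hr => exact ⟨.outer a r ν f hν h hr⟩

lemma Strat.nonneg {a : A} {r : ℝ} (h₁ : Proper R₁) (h₂ : Proper R₂)
    (hH : ∀ a r, H a r → 0 ≤ r) (t : Strat R₁ R₂ H a r) : 0 ≤ r := by
  induction t with
  | halt a r h => exact zero_le_one.trans h
  | inner a r ν f hν _ hr ih => exact (expect_nonneg (h₁ _ _ hν) ih).trans hr
  | outer a r ν f hν h hr =>
    exact (expect_nonneg (h₂ _ _ hν) fun q hq => hH _ _ (h q hq)).trans hr

/-- A state of a strategy: the current object, the bound, and what to do next. -/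
structure StratState (R₁ R₂ : A → Multiset (ℝ × A) → Prop) where
  lab : A
  bound : ℝ
  strat : Strat R₁ R₂ (Val R₁ R₂) lab bound

/-- A state for a bounded object. -/
noncomputable def Val.state {a : A} {r : ℝ} (h : Val R₁ R₂ a r) : StratState R₁ R₂ :=
  ⟨a, r, h.below.nonempty_strat.some⟩

namespace StratState

/-- The successors of a state. -/
noncomputable def succ : StratState R₁ R₂ → List (ℝ × StratState R₁ R₂)
  | ⟨_, _, .halt _ _ _⟩ => []
  | ⟨_, _, .inner _ _ ν f _ h _⟩ =>
      (ν.attach.map fun q => (q.1.1, ⟨q.1.2, f q.1.2, h q.1 q.2⟩)).toList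
  | ⟨_, _, .outer _ _ ν _ _ h _⟩ =>
      (ν.attach.map fun q => (q.1.1, (h q.1 q.2).state)).toList

/-- The states where the strategy makes a step with `R₂`. -/
def outerStates (R₁ R₂ : A → Multiset (ℝ × A) → Prop) : Set (StratState R₁ R₂)
  | ⟨_, _, .halt _ _ _⟩ => False
  | ⟨_, _, .inner _ _ _ _ _ _ _⟩ => False
  | ⟨_, _, .outer _ _ _ _ _ _ _⟩ => True

lemma map_succ_inner {a r ν f hν h hr} {B : Type*} (F : ℝ × A × ℝ → B) :
    (((⟨a, r, .inner a r ν f hν h hr⟩ : StratState R₁ R₂).succ.map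
      fun q => F (q.1, q.2.lab, q.2.bound) : List B) : Multiset B) =
        ν.map fun q => F (q.1, q.2, f q.2) := by
  rw [← Multiset.map_coe, succ, Multiset.coe_toList, Multiset.map_map]
  exact Multiset.attach_map_val' ν fun q => F (q.1, q.2, f q.2)

lemma map_succ_outer {a r ν f hν h hr} {B : Type*} (F : ℝ × A × ℝ → B) :
    (((⟨a, r, .outer a r ν f hν h hr⟩ : StratState R₁ R₂).succ.map
      fun q => F (q.1, q.2.lab, q.2.bound) : List B) : Multiset B) =
        ν.map fun q => F (q.1, q.2, f q.2) := by
  rw [← Multiset.map_coe, succ, Multiset.coe_toList, Multiset.map_map]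
  exact Multiset.attach_map_val' ν fun q => F (q.1, q.2, f q.2)

/-- Successors of an inner state carry proper subderivations, and halting states have no successors.
-/
lemma wf : WellFounded fun w' w : StratState R₁ R₂ =>
    w ∉ outerStates R₁ R₂ ∧ ∃ q ∈ w.succ, q.2 = w' := by
  refine ⟨fun ⟨a, r, t⟩ => ?_⟩
  induction t with
  | halt a r h =>
    refine ⟨_, ?_⟩
    rintro w ⟨-, q, hq, rfl⟩
    simp [succ] at hq
  | inner a r ν f hν h hr ih =>
    refine ⟨_, ?_⟩
    rintro w ⟨-, q, hq, rfl⟩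
    simp only [succ, Multiset.mem_toList, Multiset.mem_map] at hq
    obtain ⟨q', -, rfl⟩ := hq
    exact ih q'.1 q'.2
  | outer a r ν f hν h hr =>
    refine ⟨_, ?_⟩
    rintro w ⟨hw, -⟩
    exact (hw trivial).elim

end StratState

end Strat

lemma DPProblem.IsIAST.ast {Q : DPProblem C D X} (h : Q.IsIAST) :
    AST (StepS Q.S) (StepPS Q.P Q.S) := by
  have h₁ := Q.isPTRS.proper_stepS
  have h₂ := Q.isPPTRS.proper_stepPS Q.S
  intro a r hv
  -- The bound of `hv.state` is `r` by definition.
  suffices ht : ∃ T : ChainTree Q, T.leafProb ≤ ENNReal.ofReal hv.state.bound by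
    obtain ⟨T, hT⟩ := ht
    rw [h T] at hT
    exact ENNReal.one_le_ofReal.1 hT
  refine exists_chainTree StratState.succ hv.state StratState.lab
    (StratState.outerStates _ _) StratState.bound ?_ ?_ StratState.wf
    (fun w => w.strat.nonneg h₁ h₂ fun a r h => h.nonneg) ?_ ?_
  · rintro ⟨a, r, _ | ⟨_, _, ν, f, hν, h, hr⟩ | ⟨_, _, ν, f, hν, h, hr⟩⟩ hw
    · exact hw.elim
    · exact hw.elim
    · have := StratState.map_succ_outer (hν := hν) (h := h) (hr := hr) fun q => (q.1, q.2.1)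
      simp only [Multiset.map_id'] at this
      rwa [this]
  · rintro ⟨a, r, _ | ⟨_, _, ν, f, hν, h, hr⟩ | ⟨_, _, ν, f, hν, h, hr⟩⟩ hw hne
    · exact (hne rfl).elim
    · have := StratState.map_succ_inner (hν := hν) (h := h) (hr := hr) fun q => (q.1, q.2.1)
      simp only [Multiset.map_id'] at this
      rwa [this]
    · exact (hw trivial).elim
  · rintro ⟨a, r, ⟨_, _, h⟩ | ⟨_, _, ν, f, hν, h, hr⟩ | ⟨_, _, ν, f, hν, h, hr⟩⟩ hw
    · exact h
    · simp only [StratState.succ, Multiset.toList_eq_nil, Multiset.map_eq_zero] at hw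
      exact ((h₁ _ _ hν).ne_zero (by simpa using congrArg Multiset.card hw)).elim
    · simp only [StratState.succ, Multiset.toList_eq_nil, Multiset.map_eq_zero] at hw
      exact ((h₂ _ _ hν).ne_zero (by simpa using congrArg Multiset.card hw)).elim
  · rintro ⟨a, r, ⟨_, _, h⟩ | ⟨_, _, ν, f, hν, h, hr⟩ | ⟨_, _, ν, f, hν, h, hr⟩⟩ hw
    · exact (hw rfl).elim
    · have := congrArg Multiset.sum
        (StratState.map_succ_inner (hν := hν) (h := h) (hr := hr) fun q => q.1 * q.2.2)
      rw [Multiset.sum_coe] at this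
      exact this.trans_le hr
    · have := congrArg Multiset.sum
        (StratState.map_succ_outer (hν := hν) (h := h) (hr := hr) fun q => q.1 * q.2.2)
      rw [Multiset.sum_coe] at this
      exact this.trans_le hr

/-! ### Splitting multisets -/

lemma exists_split_of_map_eq_add {A B : Type*} {f : A → B} {m : Multiset A} {c d : Multiset B}
    (h : m.map f = c + d) : ∃ m₁ m₂, m = m₁ + m₂ ∧ m₁.map f = c ∧ m₂.map f = d := by
  induction c using Multiset.induction_on generalizing m with
  | empty => exact ⟨0, m, by simp, by simp, by simpa using h⟩
  | cons b c ih =>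
    rw [Multiset.cons_add] at h
    obtain ⟨x, hx, rfl⟩ := Multiset.mem_map.1 (h ▸ Multiset.mem_cons_self b (c + d))
    obtain ⟨m', rfl⟩ := Multiset.exists_cons_of_mem hx
    rw [Multiset.map_cons, Multiset.cons_inj_right] at h
    obtain ⟨m₁, m₂, rfl, rfl, rfl⟩ := ih h
    exact ⟨x ::ₘ m₁, m₂, by simp, by simp, rfl⟩

lemma cons_eq_add_cases {A : Type*} {x : A} {m c d : Multiset A} (h : x ::ₘ m = c + d) :
    (∃ c', c = x ::ₘ c' ∧ m = c' + d) ∨ (∃ d', d = x ::ₘ d' ∧ m = c + d') := by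
  rcases Multiset.mem_add.1 (h ▸ Multiset.mem_cons_self x m) with hx | hx
  · obtain ⟨c', rfl⟩ := Multiset.exists_cons_of_mem hx
    rw [Multiset.cons_add, Multiset.cons_inj_right] at h
    exact .inl ⟨c', rfl, h⟩
  · obtain ⟨d', rfl⟩ := Multiset.exists_cons_of_mem hx
    rw [Multiset.add_cons, Multiset.cons_inj_right] at h
    exact .inr ⟨d', rfl, h⟩

/-! ### Subterms and normal forms -/

lemma subtermAt_append {L : FirstOrder.Language.{u, v}} {X : Type w} (t : L.Term X) (π π' : Pos) :
    subtermAt t (π ++ π') = (subtermAt t π).bind fun u => subtermAt u π' := by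
  induction π generalizing t with
  | nil => simp [subtermAt]
  | cons i π ih =>
    cases t with
    | var x => simp [subtermAt]
    | @func n f ts =>
      rw [List.cons_append, subtermAt, subtermAt]
      split_ifs with h
      · exact ih _
      · rfl

variable {S : Set (PRule C D X)}

lemma mem_NF_of_subterm {t s : ETerm C D X} (ht : t ∈ NF S) {π : Pos}
    (h : subtermAt t π = some s) : s ∈ NF S := by
  rintro μ ⟨ρ, hρ, π', σ, hs, -⟩
  refine ht _ ⟨ρ, hρ, π ++ π', σ, ?_, rfl⟩
  rw [subtermAt_append, h, Option.bind_some, hs]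

lemma not_rewrites_np_of_mem_NF {t : ETerm C D X} (ht : t ∈ NF S) (t' : ETerm C D X) :
    ¬ Rewrites (np S) t t' := by
  rintro ⟨_, ⟨ρ, hρ, hl, -⟩, π, σ, hs, -⟩
  exact ht _ ⟨ρ, hρ, π, σ, hl ▸ hs, rfl⟩

/-- All proper subterms of the instance of the left-hand side are normal forms. -/
def RedexNF (S : Set (PRule C D X)) (ρ : PRule C D X) (σ : X → ETerm C D X) : Prop :=
  ∀ t, IsProperSubterm t ((emb ρ.lhs).subst σ) → t ∈ NF S

/-- The terms `ℓ#σ` and `ℓσ` differ only in their root symbol and so have the same proper subterms.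
Thus the rewriting that accompanies a `P`-step is innermost. -/
lemma redexNF_of_sharp {ρ : CoupledDT C D X} (hρ : HasDefinedRoot ρ.lhs) {σ : X → ETerm C D X}
    (h : ρ.lhsSharp.subst σ ∈ NF S) : RedexNF S ρ.proj₂ σ := by
  rintro t ⟨_ | ⟨i, π⟩, hπ, ht⟩
  · exact (hπ rfl).elim
  · obtain ⟨n, f, ts, hl⟩ := hρ
    refine mem_NF_of_subterm (π := i :: π) h ?_
    rw [← ht]
    simp only [CoupledDT.lhsSharp, CoupledDT.proj₂, hl]
    rfl

/-! ### Simultaneous rewriting -/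

/-- All terms with a position contain the instance of the left-hand side of `ρ ∈ S` there. -/
def SideOK (S : Set (PRule C D X)) (ρ : PRule C D X) (σ : X → ETerm C D X)
    (rest : Multiset (ETerm C D X × Option Pos)) : Prop :=
  ∀ x ∈ rest, ∀ τ, x.2 = some τ → ρ ∈ S ∧ subtermAt x.1 τ = some ((emb ρ.lhs).subst σ)

variable {ρ : PRule C D X} {σ : X → ETerm C D X} {rest : Multiset (ETerm C D X × Option Pos)}

/-- The main argument joins the others, with its position recorded; a split of the compound term
then need not ask which part contains it. -/
lemma StepS.exists_sideOK {a : Compound C D X} {ν : Multiset (ℝ × Compound C D X)}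
    (h : StepS S a ν) : ∃ ρ ∈ S, ∃ σ rest, SideOK S ρ σ rest ∧ RedexNF S ρ σ ∧
      rest.map Prod.fst = a ∧
      ν = ρ.rhs.map fun q => (q.1, rest.map fun x => stepSide x ((emb q.2).subst σ)) := by
  obtain ⟨ρ, hρ, σ, s, π, rest, rfl, hs, hnf, hrest, rfl⟩ := h
  refine ⟨ρ, hρ, σ, (s, some π) ::ₘ rest, ?_, hnf, by simp, by simp [stepSide]⟩
  intro x hx τ hτ
  rcases Multiset.mem_cons.1 hx with rfl | hx
  · cases hτ
    exact ⟨hρ, hs⟩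
  · exact ⟨hρ, hrest x hx τ hτ⟩

lemma stepS_of_sideOK (h : SideOK S ρ σ rest) (hnf : RedexNF S ρ σ)
    (hex : ∃ x ∈ rest, x.2 ≠ none) : StepS S (rest.map Prod.fst)
      (ρ.rhs.map fun q => (q.1, rest.map fun x => stepSide x ((emb q.2).subst σ))) := by
  obtain ⟨⟨s, o⟩, hx, ho⟩ := hex
  obtain ⟨π, rfl⟩ := Option.ne_none_iff_exists'.1 ho
  have hs := h _ hx π rfl
  obtain ⟨rest, rfl⟩ := Multiset.exists_cons_of_mem hx
  exact ⟨ρ, hs.1, σ, s, π, rest, by simp, hs.2, hnf,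
    fun x hx τ hτ => (h x (Multiset.mem_cons_of_mem hx) τ hτ).2, by simp [stepSide]⟩

lemma map_stepSide_of_none (h : ∀ x ∈ rest, x.2 = none) (s : ETerm C D X) :
    (rest.map fun x => stepSide x s) = rest.map Prod.fst :=
  Multiset.map_congr rfl fun x hx => by simp [stepSide, h x hx]

/-- Simultaneous rewriting can be done by a step with `S`, or it has no effect. -/
lemma Below.of_sideOK {R : Compound C D X → Multiset (ℝ × Compound C D X) → Prop}
    {H : Compound C D X → ℝ → Prop} {r : ℝ} (hS : IsPTRS S) (h : SideOK S ρ σ rest)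
    (hnf : RedexNF S ρ σ) (hd : IsMultiDist ρ.rhs) {ι : Type*} {μ : Multiset ι} {p : ι → ℝ}
    {b : ι → BTerm C D X} {t : ι → ℝ} (hμ : ρ.rhs = μ.map fun i => (p i, b i))
    (hb : ∀ i ∈ μ, Below (StepS S) R H
      (rest.map fun x => stepSide x ((emb (b i)).subst σ)) (t i))
    (hr : (μ.map fun i => p i * t i).sum ≤ r) :
    Below (StepS S) R H (rest.map Prod.fst) r := by
  by_cases hex : ∃ x ∈ rest, x.2 ≠ none
  · have hs := stepS_of_sideOK h hnf hex
    rw [hμ, Multiset.map_map] at hs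
    exact .inner_of_index hS.proper_stepS hs hb hr
  -- No term is rewritten, so all branches lead to the same compound term.
  · push Not at hex
    rw [hμ] at hd
    refine .of_idle (fun i hi => (hd.1 (p i, b i) (Multiset.mem_map.2 ⟨i, hi, rfl⟩)).1.le)
      ?_ (fun i hi => ?_) hr
    · have := hd.2
      rwa [Multiset.map_map] at this
    · rw [← map_stepSide_of_none hex]
      exact hb i hi

/-! ### Terms from which `P` can be used -/

/-- `t` can be rewritten innermost to a redex of `P`. -/
def Live (S : Set (PRule C D X)) (P : Set (CoupledDT C D X)) (t : ETerm C D X) : Prop :=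
  ∃ ρ ∈ P, ∃ σ, Relation.ReflTransGen (InnermostRewrites (np S)) t (ρ.lhsSharp.subst σ) ∧
    ρ.lhsSharp.subst σ ∈ NF S

/-- The dependency tuples of `P₁` do not create terms from which `P₂` can be used. -/
def NoEdge (S : Set (PRule C D X)) (P₁ P₂ : Set (CoupledDT C D X)) : Prop :=
  ∀ ρ ∈ P₁, ∀ σ, ρ.lhsSharp.subst σ ∈ NF S → ∀ q ∈ ρ.rhs, ∀ t ∈ q.2.1, ¬ Live S P₂ (t.subst σ)

variable {P P₁ P₂ : Set (CoupledDT C D X)}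

/-- Simultaneous rewriting is an innermost step of `np S` in each affected term, so a live result
would make the original term live. -/
lemma SideOK.not_live (h : SideOK S ρ σ rest) (hnf : RedexNF S ρ σ)
    (hrest : ∀ t ∈ rest.map Prod.fst, ¬ Live S P t) {q : ℝ × BTerm C D X} (hq : q ∈ ρ.rhs) :
    ∀ t ∈ rest.map (fun x => stepSide x ((emb q.2).subst σ)), ¬ Live S P t := by
  intro t ht
  obtain ⟨⟨s, o⟩, hx, rfl⟩ := Multiset.mem_map.1 ht
  have hs := hrest s (Multiset.mem_map.2 ⟨_, hx, rfl⟩)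
  cases o with
  | none => exact hs
  | some τ =>
    obtain ⟨hρ, hτ⟩ := h _ hx τ rfl
    rintro ⟨ρ', hρ', σ', hred, hn⟩
    refine hs ⟨ρ', hρ', σ', .head ?_ hred, hn⟩
    exact ⟨(ρ.lhs, q.2), ⟨ρ, hρ, rfl, q, hq, rfl⟩, τ, σ, hτ,
      fun t ht => not_rewrites_np_of_mem_NF (hnf t ht), rfl⟩

lemma SideOK.of_add_left {rest' : Multiset (ETerm C D X × Option Pos)}
    (h : SideOK S ρ σ (rest + rest')) : SideOK S ρ σ rest :=
  fun x hx => h x (Multiset.mem_add.2 (.inl hx))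

lemma SideOK.of_add_right {rest' : Multiset (ETerm C D X × Option Pos)}
    (h : SideOK S ρ σ (rest + rest')) : SideOK S ρ σ rest' :=
  fun x hx => h x (Multiset.mem_add.2 (.inr hx))

/-! ### Adding terms that are not used -/

/-- Steps stay possible if a compound term is enlarged. -/
def Frame (R : Compound C D X → Multiset (ℝ × Compound C D X) → Prop) : Prop :=
  ∀ a ν e, R a ν → R (a + e) (ν.map fun q => (q.1, q.2 + e))

lemma frame_stepS : Frame (StepS S) := by
  rintro _ _ e ⟨ρ, hρ, σ, s, π, rest, rfl, hs, hnf, hrest, rfl⟩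
  refine ⟨ρ, hρ, σ, s, π, rest + e.map fun t => (t, none), ?_, hs, hnf, ?_, ?_⟩
  · simp
  · intro x hx τ hτ
    rcases Multiset.mem_add.1 hx with hx | hx
    · exact hrest x hx τ hτ
    · obtain ⟨t, -, rfl⟩ := Multiset.mem_map.1 hx
      cases hτ
  · simp [stepSide]

lemma frame_stepPS : Frame (StepPS P S) := by
  rintro _ _ e ⟨ρ, hρ, σ, rest, rfl, hnf, hrest, rfl⟩
  refine ⟨ρ, hρ, σ, rest + e.map fun t => (t, none), ?_, hnf, ?_, ?_⟩
  · simp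
  · intro x hx τ hτ
    rcases Multiset.mem_add.1 hx with hx | hx
    · exact hrest x hx τ hτ
    · obtain ⟨t, -, rfl⟩ := Multiset.mem_map.1 hx
      cases hτ
  · simp [stepSide, add_assoc]

lemma Below.frame {R₁ R₂ : Compound C D X → Multiset (ℝ × Compound C D X) → Prop}
    {H : Compound C D X → ℝ → Prop} {a : Compound C D X} {r : ℝ} (h₁ : Proper R₁)
    (h₂ : Proper R₂) (hf₁ : Frame R₁) (hf₂ : Frame R₂)
    (hH : ∀ b s e, H b s → H (b + e) s) (h : Below R₁ R₂ H a r) (e : Compound C D X) :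
    Below R₁ R₂ H (a + e) r := by
  induction h with
  | halt a r h => exact .halt _ r h
  | inner a r ν f hν _ hr ih => exact .inner_of_index h₁ (hf₁ _ _ e hν) ih hr
  | outer a r ν f hν h hr =>
    exact .outer_of_index h₂ (hf₂ _ _ e hν) (fun q hq => hH _ _ e (h q hq)) hr

/-! ### Removing the terms from which `P₂` cannot be used -/

/-- If `P₁` does not create terms from which `P₂` can be used, then it does not matter for
termination whether steps with `P₁` are possible. -/
theorem AST.of_noEdge (hS : IsPTRS S) (h₁ : IsPPTRS P₁) (h₂ : IsPPTRS P₂)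
    (hno : NoEdge S P₁ P₂) (hast : AST (StepS S) (StepPS P₂ S)) :
    AST (fun a ν => StepS S a ν ∨ StepPS P₁ S a ν) (StepPS P₂ S) := by
  set V := Val (fun a ν => StepS S a ν ∨ StepPS P₁ S a ν) (StepPS P₂ S) with hV
  -- The original strategy is at `c₀ + d`. The simulating one has dropped the dead terms `d` and
  -- carries leftover terms `e` that it never touches.
  set K : Compound C D X → ℝ → Prop := fun c r =>
    ∃ c₀ e d, c = c₀ + e ∧ (∀ t ∈ d, ¬ Live S P₂ t) ∧ V (c₀ + d) r with hK
  have hK_add : ∀ b s e, K b s → K (b + e) s := by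
    rintro _ s e ⟨c₀, e', d, rfl, hd, hv⟩
    exact ⟨c₀, e' + e, d, by rw [add_assoc], hd, hv⟩
  have frame : ∀ {c r} e, Below (StepS S) (StepPS P₂ S) K c r →
      Below (StepS S) (StepPS P₂ S) K (c + e) r := fun e h =>
    h.frame hS.proper_stepS (h₂.proper_stepPS S) frame_stepS frame_stepPS hK_add e
  have key : ∀ a r, Below (fun a ν => StepS S a ν ∨ StepPS P₁ S a ν) (StepPS P₂ S) V a r →
      ∀ c d, a = c + d → (∀ t ∈ d, ¬ Live S P₂ t) → Below (StepS S) (StepPS P₂ S) K c r := by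
    intro a r h
    induction h with
    | halt a r h => exact fun c d _ _ => .halt c r h
    | inner a r ν f hν _ hr ih =>
      rintro c d rfl hd
      rcases hν with hν | hν
      · obtain ⟨ρ, hρ, σ, rest, hok, hnf, hrest, rfl⟩ := hν.exists_sideOK
        obtain ⟨rc, rd, rfl, rfl, rfl⟩ := exists_split_of_map_eq_add hrest
        rw [expect, Multiset.map_map] at hr
        refine .of_sideOK hS hok.of_add_left hnf (hS.2 ρ hρ).1 (p := Prod.fst) (b := Prod.snd)
          (by simp) (fun q hq => ?_) hr
        exact ih _ (Multiset.mem_map.2 ⟨q, hq, rfl⟩) _ _ (by simp)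
          (hok.of_add_right.not_live hnf hd hq)
      · obtain ⟨ρ, hρ, σ, rest, heq, hn, hok, rfl⟩ := hν
        have hnf := redexNF_of_sharp (h₁.2.2 ρ hρ).1 hn
        have hok : SideOK S ρ.proj₂ σ rest := hok
        have hnew := hno ρ hρ σ hn
        rw [expect, Multiset.map_map] at hr
        have main : ∀ rc rd, rest = rc + rd → (∀ t ∈ rd.map Prod.fst, ¬ Live S P₂ t) →
            Below (StepS S) (StepPS P₂ S) K (rc.map Prod.fst) r := by
          rintro rc rd rfl hrd
          refine .of_sideOK hS hok.of_add_left hnf (h₁.2.1.2 _ ⟨ρ, hρ, rfl⟩).1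
            (μ := ρ.rhs) (p := Prod.fst) (b := fun q => q.2.2) rfl (fun q hq => ?_) hr
          refine ih _ (Multiset.mem_map.2 ⟨q, hq, rfl⟩) _
            (q.2.1.map (fun t => t.subst σ) + rd.map fun x => stepSide x ((emb q.2.2).subst σ))
            ?_ ?_
          · rw [Multiset.map_add, add_left_comm]
          · intro t ht
            rcases Multiset.mem_add.1 ht with ht | ht
            · obtain ⟨s, hs, rfl⟩ := Multiset.mem_map.1 ht
              exact hnew q hq s hs
            · exact hok.of_add_right.not_live hnf hrd (q := (q.1, q.2.2))
                (Multiset.mem_map.2 ⟨q, hq, rfl⟩) t ht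
        -- If the main term of the `P₁`-step is among the retained terms, it is kept as an unused
        -- leftover; the terms that replace it in the original are dead and are dropped. If it is
        -- among the dropped terms, nothing is left over.
        rcases cons_eq_add_cases heq.symm with ⟨c', rfl, hm⟩ | ⟨d', rfl, hm⟩
        · obtain ⟨rc, rd, rfl, rfl, rfl⟩ := exists_split_of_map_eq_add hm
          rw [← Multiset.singleton_add, add_comm]
          exact frame _ (main rc rd rfl hd)
        · obtain ⟨rc, rd, rfl, rfl, rfl⟩ := exists_split_of_map_eq_add hm
          exact main rc rd rfl fun t ht => hd t (Multiset.mem_cons_of_mem ht)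
    | outer a r ν f hν h hr =>
      rintro c d rfl hd
      obtain ⟨ρ, hρ, σ, rest, heq, hn, hok, rfl⟩ := hν
      have hnf := redexNF_of_sharp (h₂.2.2 ρ hρ).1 hn
      rcases cons_eq_add_cases heq.symm with ⟨c', rfl, hm⟩ | ⟨d', rfl, hm⟩
      · obtain ⟨rc, rd, rfl, rfl, rfl⟩ := exists_split_of_map_eq_add hm
        have hok : SideOK S ρ.proj₂ σ (rc + rd) := hok
        rw [expect, Multiset.map_map] at hr
        refine .outer_of_index (μ := ρ.rhs) (p := Prod.fst) (h₂.proper_stepPS S)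
          ⟨ρ, hρ, σ, rc, rfl, hn, hok.of_add_left, rfl⟩ (fun q hq => ?_) hr
        refine ⟨_, 0, rd.map fun x => stepSide x ((emb q.2.2).subst σ), (add_zero _).symm,
          hok.of_add_right.not_live hnf hd (q := (q.1, q.2.2))
            (Multiset.mem_map.2 ⟨q, hq, rfl⟩), ?_⟩
        have := h _ (Multiset.mem_map.2 ⟨q, hq, rfl⟩)
        simp only [Multiset.map_add, ← add_assoc] at this ⊢
        exact this
      -- A dropped term cannot be the main term: a redex of `P₂` is live by a reduction of length
      -- zero.
      · exact (hd _ (Multiset.mem_cons_self _ _) ⟨ρ, hρ, σ, .refl, hn⟩).elim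
  intro a r hv
  refine hast a r ⟨K, ?_, a, 0, 0, by simp, by simp, by simpa using hv⟩
  rintro _ s ⟨c₀, e, d, rfl, hd, hv⟩
  exact ⟨hv.nonneg, frame e (key _ _ hv.below c₀ d rfl hd)⟩

/-- If `P` does not create terms from which `P` can be used, then all paths are finite. -/
theorem AST.of_noEdge_self (hS : IsPTRS S) (hP : IsPPTRS P) (hno : NoEdge S P P) :
    AST (StepS S) (StepPS P S) := by
  -- Lexicographic induction: `S`-steps keep the size of `c` and pass to a subderivation; a `P`-step
  -- removes its main term from `c`, and all new terms join the dead part `d`.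
  have key : ∀ n a r, Below (StepS S) (StepPS P S) (Val (StepS S) (StepPS P S)) a r →
      ∀ c d, a = c + d → (∀ t ∈ d, ¬ Live S P t) → c.card = n → 1 ≤ r := by
    intro n
    induction n using Nat.strong_induction_on with
    | _ n ihn =>
      intro a r h
      induction h with
      | halt a r h => exact fun _ _ _ _ _ => h
      | inner a r ν f hν _ hr ih =>
        rintro c d rfl hd hc
        have hdist := hS.proper_stepS _ _ hν
        obtain ⟨ρ, hρ, σ, rest, hok, hnf, hrest, rfl⟩ := hν.exists_sideOK
        obtain ⟨rc, rd, rfl, rfl, rfl⟩ := exists_split_of_map_eq_add hrest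
        refine le_trans ?_ hr
        rw [← expect_const hdist 1]
        refine expect_mono hdist fun q' hq' => ?_
        obtain ⟨q, hq, rfl⟩ := Multiset.mem_map.1 hq'
        exact ih _ hq' _ _ (by simp; rfl) (hok.of_add_right.not_live hnf hd hq)
          (by simpa using hc)
      | outer a r ν f hν h hr =>
        rintro c d rfl hd hc
        have hdist := hP.proper_stepPS S _ _ hν
        obtain ⟨ρ, hρ, σ, rest, heq, hn, hok, rfl⟩ := hν
        have hnf := redexNF_of_sharp (hP.2.2 ρ hρ).1 hn
        rcases cons_eq_add_cases heq.symm with ⟨c', rfl, hm⟩ | ⟨d', rfl, hm⟩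
        · obtain ⟨rc, rd, rfl, rfl, rfl⟩ := exists_split_of_map_eq_add hm
          have hok : SideOK S ρ.proj₂ σ (rc + rd) := hok
          refine le_trans ?_ hr
          rw [← expect_const hdist 1]
          refine expect_mono hdist fun q' hq' => ?_
          obtain ⟨q, hq, rfl⟩ := Multiset.mem_map.1 hq'
          refine ihn rc.card ?_ _ _ (h _ hq').below
            (rc.map fun x => stepSide x ((emb q.2.2).subst σ))
            (q.2.1.map (fun t => t.subst σ) +
              rd.map fun x => stepSide x ((emb q.2.2).subst σ)) ?_ ?_ (by simp)
          · rw [← hc]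
            simp
          · rw [Multiset.map_add, add_left_comm]
          · intro t ht
            rcases Multiset.mem_add.1 ht with ht | ht
            · obtain ⟨s, hs, rfl⟩ := Multiset.mem_map.1 ht
              exact hno ρ hρ σ hn q hq s hs
            · exact hok.of_add_right.not_live hnf hd (q := (q.1, q.2.2))
                (Multiset.mem_map.2 ⟨q, hq, rfl⟩) t ht
        · exact (hd _ (Multiset.mem_cons_self _ _) ⟨ρ, hρ, σ, .refl, hn⟩).elim
  intro a r hv
  exact key _ a r hv.below a 0 (by simp) (by simp) rfl

/-! ### The dependency graph -/

namespace DPProblem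

variable {Q : DPProblem C D X}

lemma noEdge_of_not_depEdge {P₁ P₂ : Set (CoupledDT C D X)} (h₁ : P₁ ⊆ Q.P) (h₂ : P₂ ⊆ Q.P)
    (h : ∀ ρ₁ ∈ P₁, ∀ ρ₂ ∈ P₂, ¬ Q.DepEdge ρ₁ ρ₂) : NoEdge Q.S P₁ P₂ := by
  rintro ρ₁ hρ₁ σ₁ hn₁ q hq t ht ⟨ρ₂, hρ₂, σ₂, hred, hn₂⟩
  exact h ρ₁ hρ₁ ρ₂ hρ₂ ⟨h₁ hρ₁, h₂ hρ₂, σ₁, σ₂, q, hq, t, ht, hred, hn₁, hn₂⟩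

/-- The nodes that are reachable from `ρ` and from which `ρ` can be reached. -/
def component (Q : DPProblem C D X) (ρ : CoupledDT C D X) : Set (CoupledDT C D X) :=
  {ρ' | Relation.ReflTransGen Q.DepEdge ρ ρ' ∧ Relation.ReflTransGen Q.DepEdge ρ' ρ}

/-- A path between nodes of a component stays in the component. -/
lemma transGen_component {ρ a b : CoupledDT C D X} (ha : a ∈ Q.component ρ)
    (hb : b ∈ Q.component ρ) (h : Relation.TransGen Q.DepEdge a b) :
    Relation.TransGen
      (fun x y => x ∈ Q.component ρ ∧ y ∈ Q.component ρ ∧ Q.DepEdge x y) a b := by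
  induction h using Relation.TransGen.head_induction_on with
  | single h => exact .single ⟨ha, hb, h⟩
  | @head a c hac hcb ih =>
    have hc : c ∈ Q.component ρ := ⟨ha.1.tail hac, hcb.to_reflTransGen.trans hb.2⟩
    exact .head ⟨ha, hc, hac⟩ (ih hc)

/-- The closed path at `ρ` makes all connecting paths non-empty, even from a node to itself.
Maximality holds because every node of a cycle containing `ρ` is mutually reachable with `ρ`. -/
lemma isSCC_component {ρ : CoupledDT C D X} (h : Relation.TransGen Q.DepEdge ρ ρ) :
    Q.IsSCC (Q.component ρ) := by
  refine ⟨⟨⟨ρ, .refl, .refl⟩, ?_, ?_⟩, ?_⟩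
  · intro ρ' hρ'
    have h' : Relation.TransGen Q.DepEdge ρ' ρ := h.trans_right hρ'.2
    obtain ⟨_, h', -⟩ := Relation.TransGen.head'_iff.1 h'
    exact h'.1
  · intro a ha b hb
    exact transGen_component ha hb ((h.trans_right ha.2).trans_left hb.1)
  · intro Z hZ hle z hz
    have hρ : ρ ∈ Z := hle ⟨.refl, .refl⟩
    have mono : ∀ {x y}, Relation.TransGen (fun x y => x ∈ Z ∧ y ∈ Z ∧ Q.DepEdge x y) x y →
        Relation.ReflTransGen Q.DepEdge x y := fun h =>
      (h.lift id fun _ _ h => h.2.2).to_reflTransGen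
    exact ⟨mono (hZ.2.2 ρ hρ z hz), mono (hZ.2.2 z hz ρ hρ)⟩

lemma component_eq_singleton {ρ : CoupledDT C D X} (h : ¬ Relation.TransGen Q.DepEdge ρ ρ) :
    Q.component ρ = {ρ} := by
  refine Set.Subset.antisymm (fun ρ' hρ' => ?_) (by
    rintro _ rfl
    exact ⟨.refl, .refl⟩)
  rcases Relation.reflTransGen_iff_eq_or_transGen.1 hρ'.1 with heq | ht
  · exact heq
  · exact (h (ht.trans_left hρ'.2)).elim

/-- A set of nodes has an element that is reachable at most from its own component. -/
lemma exists_source {P : Set (CoupledDT C D X)} (hfin : P.Finite) (hne : P.Nonempty) :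
    ∃ ρ ∈ P, ∀ ρ' ∈ P, Relation.ReflTransGen Q.DepEdge ρ' ρ →
      Relation.ReflTransGen Q.DepEdge ρ ρ' := by
  let pred : CoupledDT C D X → Set (CoupledDT C D X) := fun ρ =>
    {ρ' ∈ P | Relation.ReflTransGen Q.DepEdge ρ' ρ}
  have hpred : ∀ ρ, (pred ρ).Finite := fun ρ => hfin.subset fun _ h => h.1
  -- A node with the fewest predecessors works: if `ρ'` reaches `ρ`, its predecessors are among
  -- those of `ρ`, so minimality makes the two sets equal, and `ρ` itself is a predecessor of `ρ'`.
  obtain ⟨ρ, hρ, hmin⟩ := hfin.exists_minimalFor (fun ρ => (pred ρ).ncard) P hne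
  refine ⟨ρ, hρ, fun ρ' hρ' h => ?_⟩
  have hsub : pred ρ' ⊆ pred ρ := fun x hx => ⟨hx.1, hx.2.trans h⟩
  have hle : (pred ρ).ncard ≤ (pred ρ').ncard :=
    hmin hρ' (Set.ncard_le_ncard hsub (hpred ρ))
  have heq := Set.eq_of_subset_of_ncard_le hsub hle (hpred ρ)
  have hmem : ρ ∈ pred ρ := ⟨hρ, .refl⟩
  rw [← heq] at hmem
  exact hmem.2

/-- If all SCCs are AST, then so are all sets of nodes that are closed under successors. -/
lemma ast_of_isSCC (hscc : ∀ Y, Q.IsSCC Y → AST (StepS Q.S) (StepPS Y Q.S))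
    {P : Set (CoupledDT C D X)} (hP : P ⊆ Q.P) (hclosed : ∀ a ∈ P, ∀ b, Q.DepEdge a b → b ∈ P) :
    AST (StepS Q.S) (StepPS P Q.S) := by
  have hS := Q.isPTRS
  induction hn : P.ncard using Nat.strong_induction_on generalizing P with
  | _ n ih =>
  have hfin : P.Finite := Q.isPPTRS.1.subset hP
  rcases P.eq_empty_or_nonempty with rfl | hne
  · exact .of_noEdge_self hS (Q.isPPTRS.mono hP) fun ρ hρ => hρ.elim
  obtain ⟨ρ, hρ, hsource⟩ := exists_source (Q := Q) hfin hne
  set Y := Q.component ρ with hY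
  have hρY : ρ ∈ Y := ⟨.refl, .refl⟩
  have hYP : Y ⊆ P := by
    intro ρ' hρ'
    induction hρ'.1 with
    | refl => exact hρ
    | @tail b c hb hbc ihb => exact hclosed _ (ihb ⟨hb, .head hbc hρ'.2⟩) _ hbc
  -- With such an edge `a` would reach `ρ`; as `ρ` is a source, `ρ` would reach `a`, so `a` would
  -- lie in `Y`.
  have hno : ∀ a ∈ P \ Y, ∀ b ∈ Y, ¬ Q.DepEdge a b := by
    intro a ha b hb hab
    have h := hb.2.head hab
    exact ha.2 ⟨hsource a ha.1 h, h⟩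
  have h₁ : IsPPTRS (P \ Y) := Q.isPPTRS.mono (Set.sdiff_subset.trans hP)
  have h₂ : IsPPTRS Y := Q.isPPTRS.mono (hYP.trans hP)
  have hastY : AST (StepS Q.S) (StepPS Y Q.S) := by
    by_cases ht : Relation.TransGen Q.DepEdge ρ ρ
    · exact hscc Y (isSCC_component ht)
    · refine .of_noEdge_self hS h₂ (noEdge_of_not_depEdge (hYP.trans hP) (hYP.trans hP) ?_)
      rw [hY, component_eq_singleton ht]
      rintro _ rfl _ rfl h
      exact ht (.single h)
  have hastP : AST (StepS Q.S) (StepPS (P \ Y) Q.S) := by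
    refine ih (P \ Y).ncard ?_ (Set.sdiff_subset.trans hP) ?_ rfl
    · rw [← hn]
      exact Set.ncard_lt_ncard ⟨Set.sdiff_subset, fun h => (h hρ).2 hρY⟩ hfin
    · exact fun a ha b hab => ⟨hclosed a ha.1 b hab, fun hb => hno a ha b hb hab⟩
  have hast := AST.of_noEdge hS h₁ h₂
    (noEdge_of_not_depEdge (Set.sdiff_subset.trans hP) (hYP.trans hP) hno) hastY
  have hstep : StepPS P Q.S = fun a ν => StepPS (P \ Y) Q.S a ν ∨ StepPS Y Q.S a ν := by
    ext a ν
    constructor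
    · rintro ⟨ρ', hρ', h⟩
      by_cases hm : ρ' ∈ Y
      · exact .inr ⟨ρ', hm, h⟩
      · exact .inl ⟨ρ', ⟨hρ', hm⟩, h⟩
    · rintro (⟨ρ', hρ', h⟩ | ⟨ρ', hρ', h⟩)
      · exact ⟨ρ', hρ'.1, h⟩
      · exact ⟨ρ', hYP hρ', h⟩
  intro a r hv
  rw [hstep] at hv
  -- `Val.partition` only provides the bounds `t > r`, which suffices by density.
  refine le_of_forall_gt_imp_ge_of_dense fun t ht => ?_
  exact hast a t (hv.partition hS.proper_stepS (h₁.proper_stepPS _) (h₂.proper_stepPS _) hastP ht)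

end DPProblem

/-! ### Completeness: restriction to fewer dependency tuples -/

lemma StepPS.mono {P P' : Set (CoupledDT C D X)} {S : Set (PRule C D X)} (hP : P ⊆ P')
    {a : Compound C D X} {ν : Multiset (ℝ × Compound C D X)} (h : StepPS P S a ν) :
    StepPS P' S a ν := by
  obtain ⟨ρ, hρ, h⟩ := h
  exact ⟨ρ, hP hρ, h⟩

lemma DPProblem.IsIAST.restrict {Q : DPProblem C D X} (h : Q.IsIAST)
    {P : Set (CoupledDT C D X)} (hP : P ⊆ Q.P) : (Q.restrict P hP).IsIAST := by
  intro T
  exact h { T with stepP := fun x hx => (T.stepP x hx).mono hP, stepS := T.stepS }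

end ProbDP

theorem mainTheorem3 (C D : FirstOrder.Language.{u, v}) (X : Type w) :
    (ProbDP.depGraphProcessor C D X).IsSound ∧ (ProbDP.depGraphProcessor C D X).IsComplete := by
  constructor
  · intro Q h
    refine ProbDP.DPProblem.isIAST_of_ast (ProbDP.DPProblem.ast_of_isSCC (fun Y hY => ?_)
      subset_rfl fun a _ b hab => hab.2.1)
    exact (h _ ⟨Y, hY, rfl⟩).ast
  · rintro Q h _ ⟨Y, hY, rfl⟩
    exact h.restrict hY.subset
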